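/- Let $p$ be a prime, let $G$ be a finite $p$-group and let $F$ be a field of characteristic $p$. Suppose that at least one of the following conditions holds: (i) $G$ has exponent $p$; (ii) $G$ has nilpotency class $2$; (iii) the commutator subgroup $G'$ is cyclic; (iv) $G$ has maximal class (that is, $|G|=p^n$ with $n\ge 2$ and $G$ has nilpotency class $n-1$) and $G$ contains an abelian subgroup of index $p$. Then the nilpotency class of $G$ is determined by the group algebra $FG$: if $H$ is any group such that $FG\cong FH$ as $F$-algebras, then $H$ is nilpotent and its nilpotency class is equal to that of $G$. -/

import Mathlib

/-- A finite `p`-group `G` has maximal class if `|G| = p ^ n` with `2 ≤ n` and its nilpotency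
class is `n - 1`. -/
def HasMaximalClass (p : ℕ) (G : Type*) [Group G] : Prop :=
  Group.IsNilpotent G ∧
    ∃ n : ℕ, 2 ≤ n ∧ Nat.card G = p ^ n ∧ Group.nilpotencyClass G = n - 1

/-! The isomorphism places two multiplicative bases, one from G and one from H, in a single algebra
A. Anything expressed through A alone is shared by both groups, so the proof recovers group data
from canonical objects: the span [A,A] of additive commutators, the ideal A[A,A], the centre, and
the set of nilpotent elements, which is the augmentation ideal I because A is a p-group algebra in
characteristic p. Dimensions of canonical subspaces modulo canonical subspaces give the number of
conjugacy classes and the orders of G', Z(G) and Z(G) ∩ G'.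

Class 2 means that Z(G) ∩ G' = G' ≠ 1, which these orders detect. In the other cases the orders of
all terms γ of the lower central series are determined.

If G' is cyclic, so is H', because cyclicity of G' is the nonvanishing of a certain power of A[A,A]
(`isCyclic_iff_augSpan_top_pow_ne_bot`). Subgroups of a cyclic p-group form a chain, whence |γ ∩ Z|
|[γ,G]| = |γ| for each term γ ≤ G' and |γ ∩ Z| = min(|γ|, |Z ∩ G'|), so the orders follow
recursively.

If G is nonabelian of maximal class with an abelian subgroup of index p, then |Z(G)| = p, |G : G'| =
p² and G has at least |G|/p² + p² - 1 conjugacy classes. These facts pass to H. Over ℂ they leave no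
room for an irreducible representation of H of degree above p. A faithful one of degree p then
yields an abelian subgroup of index p in H (`IsPGroup.exists_isMulCommutative_index_eq`), and the
same recursion runs in both groups.

If G has exponent p, let r_n be the dimension of the degree n + 1 part of the Lie algebra generated
by degree one in the graded algebra of the powers of I. It depends only on I. Always p^(r_n) is at
most the order of the n-th lower central factor, counted from 0. Exponent p gives |G| ≤ p^(Σ r_n) by
a Poincaré-Birkhoff-Witt spanning argument (`card_le_pow_sum_lieRank`), so equality holds
throughout, for H as well. -/

/-! ### Group bases and the augmentation ideal -/

section GroupBasis

open Module
open scoped commutatorElement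

variable {F A G H : Type*} [Field F] [Ring A] [Algebra F A] [Group G] [Group H]

/-- A basis of an algebra indexed by a group and multiplicative, i.e. an identification of the
algebra with the group algebra. -/
def IsGroupBasis (u : Basis G F A) : Prop := ∀ g h, u (g * h) = u g * u h

theorem Module.Basis.elim_induction {ι : Type*} (u : Basis ι F A) {P : A → Prop} (zero : P 0)
    (add : ∀ x y, P x → P y → P (x + y)) (smul : ∀ (c : F) x, P x → P (c • x))
    (coe : ∀ i, P (u i)) (a : A) : P a := by
  have ha : a ∈ Submodule.span F (Set.range u) := by rw [u.span_eq]; trivial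
  induction ha using Submodule.span_induction with
  | mem x hx => obtain ⟨i, rfl⟩ := hx; exact coe i
  | zero => exact zero
  | add x y _ _ hx hy => exact add x y hx hy
  | smul c x _ hx => exact smul c x hx

namespace IsGroupBasis

variable {u : Basis G F A}

theorem mul (hu : IsGroupBasis u) (g h : G) : u (g * h) = u g * u h := hu g h

theorem one (hu : IsGroupBasis u) : u 1 = 1 := by
  have h : LinearMap.mulLeft F (u 1) = LinearMap.id :=
    u.ext fun g => by simp [← hu.mul]
  simpa using congrArg (fun f => f (1 : A)) h

theorem inv_mul (hu : IsGroupBasis u) (g : G) : u g⁻¹ * u g = 1 := by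
  rw [← hu.mul, inv_mul_cancel, hu.one]

theorem mul_inv (hu : IsGroupBasis u) (g : G) : u g * u g⁻¹ = 1 := by
  rw [← hu.mul, mul_inv_cancel, hu.one]

theorem pow (hu : IsGroupBasis u) (g : G) (n : ℕ) : u (g ^ n) = u g ^ n := by
  induction n with
  | zero => simp [hu.one]
  | succ n ih => rw [pow_succ, hu.mul, ih, pow_succ]

theorem nontrivial (_ : IsGroupBasis u) : Nontrivial A :=
  ⟨u 1, 0, u.ne_zero 1⟩

end IsGroupBasis

/-- The augmentation with respect to a group basis. -/
noncomputable def augmentation (u : Basis G F A) : A →ₗ[F] F := u.constr F fun _ => 1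

omit [Group G] in
@[simp] theorem augmentation_basis (u : Basis G F A) (g : G) : augmentation u (u g) = 1 := by
  simp [augmentation, Basis.constr_basis]

theorem augmentation_mul {u : Basis G F A} (hu : IsGroupBasis u) (a b : A) :
    augmentation u (a * b) = augmentation u a * augmentation u b := by
  have h : (LinearMap.mul F A).compr₂ (augmentation u) =
      (LinearMap.mul F F).compl₁₂ (augmentation u) (augmentation u) :=
    u.ext fun g => u.ext fun h => by simp [← hu.mul]
  exact congrArg (fun f => f a b) h

theorem augmentation_one {u : Basis G F A} (hu : IsGroupBasis u) : augmentation u 1 = 1 := by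
  rw [← hu.one, augmentation_basis]

theorem augmentation_pow {u : Basis G F A} (hu : IsGroupBasis u) (a : A) (n : ℕ) :
    augmentation u (a ^ n) = augmentation u a ^ n := by
  induction n with
  | zero => simp [augmentation_one hu]
  | succ n ih => rw [pow_succ, augmentation_mul hu, ih, pow_succ]

/-- The span of the elements `n - 1` for `n` in a subgroup. -/
def augSpan (u : Basis G F A) (N : Subgroup G) : Submodule F A :=
  Submodule.span F ((fun n => u n - 1) '' (N : Set G))

theorem sub_one_mem_augSpan (u : Basis G F A) {N : Subgroup G} {n : G} (hn : n ∈ N) :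
    u n - 1 ∈ augSpan u N :=
  Submodule.subset_span ⟨n, hn, rfl⟩

theorem augSpan_le {u : Basis G F A} {N : Subgroup G} {V : Submodule F A} :
    augSpan u N ≤ V ↔ ∀ n ∈ N, u n - 1 ∈ V := by
  simp [augSpan, Submodule.span_le, Set.subset_def]

theorem sub_augmentation_mem {u : Basis G F A} (a : A) :
    a - algebraMap F A (augmentation u a) ∈ augSpan u ⊤ := by
  induction a using u.elim_induction with
  | zero => simp
  | add x y hx hy => 
    rw [map_add, map_add, add_sub_add_comm]
    exact add_mem hx hy
  | smul c x hx =>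
    rw [map_smul, smul_eq_mul, map_mul, ← Algebra.smul_def, ← smul_sub]
    exact Submodule.smul_mem _ _ hx
  | coe g =>
    simpa using sub_one_mem_augSpan u (N := ⊤) (Subgroup.mem_top g)

theorem mem_augSpan_top_iff {u : Basis G F A} (hu : IsGroupBasis u) {a : A} :
    a ∈ augSpan u ⊤ ↔ augmentation u a = 0 := by
  constructor
  · intro h
    have : augSpan u ⊤ ≤ LinearMap.ker (augmentation u) :=
      augSpan_le.2 fun n _ => by simp [augmentation_one hu]
    exact this h
  · intro h
    simpa [h] using sub_augmentation_mem (u := u) a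

theorem mul_mem_augSpan_top {u : Basis G F A} (hu : IsGroupBasis u) (a : A) {b : A}
    (hb : b ∈ augSpan u ⊤) : a * b ∈ augSpan u ⊤ := by
  rw [mem_augSpan_top_iff hu] at *
  rw [augmentation_mul hu, hb, mul_zero]

theorem mul_mem_augSpan_top' {u : Basis G F A} (hu : IsGroupBasis u) {a : A} (b : A)
    (ha : a ∈ augSpan u ⊤) : a * b ∈ augSpan u ⊤ := by
  rw [mem_augSpan_top_iff hu] at *
  rw [augmentation_mul hu, ha, zero_mul]

/-- A finite `p`-group acting linearly on a nonzero module in characteristic `p` fixes a nonzero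
vector. -/
theorem IsPGroup.exists_fixed_vector {p : ℕ} [Fact p.Prime] [CharP F p] [Finite G]
    (hG : IsPGroup p G) (u : G →* A) (M : Type*) [AddCommGroup M] [Module A M] [Nontrivial M] :
    ∃ v : M, v ≠ 0 ∧ ∀ g, u g • v = v := by
  obtain ⟨m, hm⟩ := exists_ne (0 : M)
  have hp : ∀ x : M, p • x = 0 := fun x => by
    have : ((p : ℕ) : A) = 0 := by
      rw [← map_natCast (algebraMap F A), CharP.cast_eq_zero, map_zero]
    rw [← Nat.cast_smul_eq_nsmul A, this, zero_smul]
  have := AddCommGroup.zmodModule hp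
  -- The field may be infinite, so the orbit is spanned over the prime field only. This gives a
  -- finite stable set in which fixed points can be counted modulo p.
  let P := Submodule.span (ZMod p) (Set.range fun g => u g • m)
  have hfin : Finite P := by
    have : Module.Finite (ZMod p) P := Module.Finite.span_of_finite _ (Set.finite_range _)
    exact Module.finite_of_finite (ZMod p)
  have hstab : ∀ g : G, ∀ x ∈ P, u g • x ∈ P := by
    intro g x hx
    let f : M →ₗ[ZMod p] M := (DistribSMul.toAddMonoidHom M (u g)).toZModLinearMap p
    have : P ≤ P.comap f := by
      refine Submodule.span_le.2 ?_
      rintro _ ⟨h, rfl⟩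
      refine Submodule.subset_span ⟨g * h, ?_⟩
      simp [f, mul_smul]
    exact this hx
  let _ : MulAction G P :=
    { smul := fun g x => ⟨u g • x.1, hstab g x.1 x.2⟩
      one_smul := fun x => Subtype.ext (by change u 1 • x.1 = x.1; simp)
      mul_smul := fun g h x => Subtype.ext (by
        change u (g * h) • x.1 = u g • u h • x.1
        rw [map_mul, mul_smul]) }
  have hmP : m ∈ P := Submodule.subset_span ⟨1, by simp⟩
  have hdvd : p ∣ Nat.card P := by
    have h1 : addOrderOf (⟨m, hmP⟩ : P) = p :=
      addOrderOf_eq_prime (Subtype.ext (hp m)) (fun h => hm (congrArg Subtype.val h))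
    exact (dvd_of_eq h1.symm).trans (addOrderOf_dvd_natCard _)
  have h0 : (0 : P) ∈ MulAction.fixedPoints G P := fun g => Subtype.ext (smul_zero (u g))
  obtain ⟨b, hb, hne⟩ := hG.exists_fixed_point_of_prime_dvd_card_of_fixed_point P hdvd h0
  exact ⟨b.1, fun h => hne (Subtype.ext h.symm), fun g => congrArg Subtype.val (hb g)⟩

/-- The augmentation ideal of a finite `p`-group in characteristic `p` is nilpotent. -/
theorem IsPGroup.augSpan_top_pow_eq_bot {p : ℕ} [Fact p.Prime] [CharP F p] [Finite G]
    (hG : IsPGroup p G) {u : Basis G F A} (hu : IsGroupBasis u) :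
    ∃ k, augSpan u ⊤ ^ k = ⊥ := by
  have : Module.Finite F A := Module.Finite.of_basis u
  have : IsNoetherianRing A := isNoetherian_of_tower F inferInstance
  -- `L` is a maximal left ideal among those killed by a power of the augmentation ideal. If it were
  -- proper, a fixed vector of `A ⧸ L` would enlarge it at the cost of one more power.
  obtain ⟨L, ⟨k, hk⟩, hmax⟩ := set_has_maximal_iff_noetherian.2 ‹IsNoetherianRing A›
    {L : Submodule A A | ∃ k, augSpan u ⊤ ^ k * Submodule.restrictScalars F L = ⊥}
    ⟨⊥, 0, by simp⟩
  rcases eq_or_ne L ⊤ with rfl | hL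
  · refine ⟨k, eq_bot_iff.2 fun x hx => ?_⟩
    rw [← hk]
    simpa using Submodule.mul_mem_mul hx (show (1 : A) ∈ (⊤ : Submodule A A).restrictScalars F from trivial)
  exfalso
  have : Nontrivial (A ⧸ L) := Submodule.Quotient.nontrivial_iff.2 hL
  let um : G →* A := ⟨⟨u, hu.one⟩, hu.mul⟩
  obtain ⟨v, hv0, hv⟩ := hG.exists_fixed_vector (F := F) um (A ⧸ L)
  obtain ⟨v, rfl⟩ := L.mkQ_surjective v
  have hvL : v ∉ L := fun h => hv0 (by simpa using h)
  have hfix : ∀ g, (u g - 1) * v ∈ L := fun g => by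
    have := hv g
    rw [← map_smul, ← sub_eq_zero, ← map_sub] at this
    have := (Submodule.Quotient.mk_eq_zero L).1 this
    simpa [sub_mul, um] using this
  refine hmax (L ⊔ Submodule.span A {v}) ⟨k + 1, ?_⟩ ?_
  · rw [pow_succ, mul_assoc, eq_bot_iff, ← hk]
    refine mul_le_mul_right ?_ _
    have key : ∀ x ∈ augSpan u ⊤, ∀ a : A, x * (a * v) ∈ L := by
      intro x hx a
      have h2 : augSpan u ⊤ ≤ (L.restrictScalars F).comap (LinearMap.mulRight F (a * v)) := by
        refine augSpan_le.2 fun h _ => ?_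
        change (u h - 1) * (a * v) ∈ L
        induction a using u.elim_induction with
        | zero => simp
        | add x y hx hy => rw [add_mul, mul_add]; exact add_mem hx hy
        | smul c x hx =>
          rw [smul_mul_assoc, mul_smul_comm, Algebra.smul_def]
          exact L.smul_mem _ hx
        | coe g =>
          have : (u h - 1) * (u g * v) = u g * ((u (g⁻¹ * h * g) - 1) * v) := by
            have : u h * u g = u g * u (g⁻¹ * h * g) := by
              rw [← hu.mul, ← hu.mul]; congr 1; group
            rw [← mul_assoc, ← mul_assoc, sub_mul, mul_sub, ← this]; simp
          rw [this]
          exact L.smul_mem (u g) (hfix _)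
      exact h2 hx
    refine Submodule.mul_le.2 fun x hx y hy => ?_
    obtain ⟨l, hl, w, hw, rfl⟩ := Submodule.mem_sup.1 hy
    obtain ⟨a, rfl⟩ := Submodule.mem_span_singleton.1 hw
    rw [mul_add]
    exact L.add_mem (L.smul_mem x hl) (key x hx a)
  · exact lt_of_le_of_ne le_sup_left fun h => hvL (by
      rw [h]; exact Submodule.mem_sup_right (Submodule.mem_span_singleton_self v))

/-- Nilpotency does not refer to a basis, so this makes the augmentation ideal canonical. -/
theorem IsPGroup.mem_augSpan_top_iff_isNilpotent {p : ℕ} [Fact p.Prime] [CharP F p] [Finite G]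
    (hG : IsPGroup p G) {u : Basis G F A} (hu : IsGroupBasis u) {a : A} :
    a ∈ augSpan u ⊤ ↔ IsNilpotent a := by
  constructor
  · intro ha
    obtain ⟨k, hk⟩ := hG.augSpan_top_pow_eq_bot hu
    exact ⟨k, by simpa [hk] using Submodule.pow_mem_pow _ ha k⟩
  · rintro ⟨k, hk⟩
    rw [mem_augSpan_top_iff hu]
    have := augmentation_pow hu a k
    rw [hk, map_zero] at this
    exact eq_zero_of_pow_eq_zero this.symm

theorem augSpan_top_eq_augSpan_top {p : ℕ} [Fact p.Prime] [CharP F p] [Finite G] [Finite H]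
    (hG : IsPGroup p G) (hH : IsPGroup p H) {u : Basis G F A} {v : Basis H F A}
    (hu : IsGroupBasis u) (hv : IsGroupBasis v) : augSpan u ⊤ = augSpan v ⊤ := by
  ext a
  rw [hG.mem_augSpan_top_iff_isNilpotent hu, hH.mem_augSpan_top_iff_isNilpotent hv]

end GroupBasis

/-! ### Orders and class numbers determined by the algebra -/

section GroupBasisInvariants

open Module
open scoped commutatorElement

variable {F A G H : Type*} [Field F] [Ring A] [Algebra F A] [Group G] [Group H]

/-- Both images are `S` modulo its intersection with the common kernel. The invariants below pass
from one group to the other in this way: the target spaces differ, but the kernel and `S` are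
canonical. -/
theorem finrank_map_eq_of_ker_eq {V W : Type*} [AddCommGroup V] [Module F V] [AddCommGroup W]
    [Module F W] {f : A →ₗ[F] V} {g : A →ₗ[F] W} (h : LinearMap.ker f = LinearMap.ker g)
    (S : Submodule F A) : finrank F (S.map f) = finrank F (S.map g) := by
  have hk : LinearMap.ker (f.domRestrict S) = LinearMap.ker (g.domRestrict S) := by
    ext x
    have := SetLike.ext_iff.1 h x.1
    simpa using this
  have e1 := (f.domRestrict S).quotKerEquivRange.finrank_eq
  have e2 := (g.domRestrict S).quotKerEquivRange.finrank_eq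
  rw [LinearMap.range_domRestrict] at e1 e2
  rw [← e1, ← e2, (Submodule.quotEquivOfEq _ _ hk).finrank_eq]

theorem finrank_span_range_single {ι : Type*} (S : Set ι) [Finite S] :
    finrank F (Submodule.span F ((fun i => Finsupp.single i (1 : F)) '' S)) = Nat.card S := by
  have := Fintype.ofFinite S
  have hli : LinearIndependent F fun i : S => Finsupp.single i.1 (1 : F) :=
    (Finsupp.linearIndependent_single_one F ι).comp _ Subtype.val_injective
  have := finrank_span_eq_card hli
  rw [Nat.card_eq_fintype_card, ← this, Set.image_eq_range]

variable (F A) in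
/-- The span of all additive commutators of an algebra. -/
def commutatorSpan : Submodule F A := Submodule.span F {x | ∃ a b : A, a * b - b * a = x}

theorem commutator_mem_commutatorSpan (a b : A) : a * b - b * a ∈ commutatorSpan F A :=
  Submodule.subset_span ⟨a, b, rfl⟩

/-- The map to functions on conjugacy classes that adds up coefficients over each class. -/
noncomputable def classMap (u : Basis G F A) : A →ₗ[F] (ConjClasses G →₀ F) :=
  u.constr F fun g => Finsupp.single (ConjClasses.mk g) 1

@[simp] theorem classMap_basis (u : Basis G F A) (g : G) :
    classMap u (u g) = Finsupp.single (ConjClasses.mk g) 1 := by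
  simp [classMap, Basis.constr_basis]

/-- Conjugate basis elements differ by an additive commutator, and `u (g * h)`, `u (h * g)` have
conjugate indices. Choosing one representative per class inverts `classMap` modulo commutators. -/
theorem ker_classMap {u : Basis G F A} (hu : IsGroupBasis u) :
    LinearMap.ker (classMap u) = commutatorSpan F A := by
  apply le_antisymm
  · let σ : (ConjClasses G →₀ F) →ₗ[F] A ⧸ commutatorSpan F A :=
      Finsupp.linearCombination F fun C => (commutatorSpan F A).mkQ (u (Quotient.out C))
    have hσ : σ ∘ₗ classMap u = (commutatorSpan F A).mkQ := by
      refine u.ext fun g => ?_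
      have hc : IsConj (Quotient.out (ConjClasses.mk g)) g :=
        ConjClasses.mk_eq_mk_iff_isConj.1 (Quotient.out_eq (ConjClasses.mk g))
      obtain ⟨x, hx⟩ := isConj_iff.1 hc
      simp only [σ, LinearMap.comp_apply, classMap_basis, Finsupp.linearCombination_single,
        one_smul]
      rw [← sub_eq_zero, ← map_sub, ← LinearMap.mem_ker, Submodule.ker_mkQ]
      have := commutator_mem_commutatorSpan (F := F) (u (Quotient.out (ConjClasses.mk g) * x⁻¹))
        (u x)
      rwa [← hu.mul, ← hu.mul, inv_mul_cancel_right, ← mul_assoc, hx] at this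
    intro a ha
    have := congrArg (fun f => f a) hσ
    rw [LinearMap.comp_apply, LinearMap.mem_ker.1 ha, map_zero] at this
    rwa [← (commutatorSpan F A).ker_mkQ, LinearMap.mem_ker, eq_comm]
  · refine Submodule.span_le.2 ?_
    rintro _ ⟨a, b, rfl⟩
    have h : (LinearMap.mul F A).compr₂ (classMap u) =
        (LinearMap.mul F A).flip.compr₂ (classMap u) := by
      refine u.ext fun g => u.ext fun h => ?_
      simp only [LinearMap.compr₂_apply, LinearMap.mul_apply_apply, LinearMap.flip_apply, ← hu.mul,
        classMap_basis]
      rw [ConjClasses.mk_eq_mk_iff_isConj.2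
        (isConj_iff.2 ⟨h, by group⟩ : IsConj (g * h) (h * g))]
    have := congrArg (fun f => f a b) h
    simpa [sub_eq_zero] using this

theorem classMap_surjective (u : Basis G F A) : Function.Surjective (classMap u) := by
  rw [← LinearMap.range_eq_top, eq_top_iff, ← Finsupp.basisSingleOne.span_eq, Submodule.span_le]
  rintro _ ⟨C, rfl⟩
  obtain ⟨g, rfl⟩ := ConjClasses.exists_rep C
  exact ⟨u g, by simp⟩

theorem finrank_map_classMap_top (u : Basis G F A) [Finite G] :
    finrank F ((⊤ : Submodule F A).map (classMap u)) = Nat.card (ConjClasses G) := by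
  rw [Submodule.map_top, LinearMap.range_eq_top.2 (classMap_surjective u), finrank_top]
  have := Fintype.ofFinite (ConjClasses G)
  simp

theorem card_conjClasses_eq [Finite G] [Finite H] {u : Basis G F A} {v : Basis H F A}
    (hu : IsGroupBasis u) (hv : IsGroupBasis v) :
    Nat.card (ConjClasses G) = Nat.card (ConjClasses H) := by
  rw [← finrank_map_classMap_top u, ← finrank_map_classMap_top v]
  exact finrank_map_eq_of_ker_eq ((ker_classMap hu).trans (ker_classMap hv).symm) _

theorem IsPGroup.dvd_card_carrier {p : ℕ} [Fact p.Prime] [Finite G] (hG : IsPGroup p G) {g : G}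
    (hg : g ∉ Subgroup.center G) : p ∣ Nat.card (ConjClasses.mk g).carrier := by
  rw [← ConjAct.orbit_eq_carrier_conjClasses]
  obtain ⟨n, hn⟩ := (hG.of_equiv ConjAct.toConjAct).card_orbit g
  rw [hn]
  refine dvd_pow_self p fun h0 => hg ?_
  rw [h0, pow_zero] at hn
  rw [← SetLike.mem_coe, ← ConjAct.fixedPoints_eq_center]
  have := (Nat.card_eq_one_iff_unique.1 hn).1
  intro x
  exact congrArg Subtype.val (Subsingleton.elim
    (⟨x • g, ⟨x, rfl⟩⟩ : MulAction.orbit (ConjAct G) g) ⟨g, MulAction.mem_orbit_self g⟩)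

theorem IsGroupBasis.repr_conj {u : Basis G F A} (hu : IsGroupBasis u) {a : A}
    (ha : a ∈ Subalgebra.center F A) (x g : G) : u.repr a (x * g * x⁻¹) = u.repr a g := by
  have hl : (Finsupp.lapply (x * g * x⁻¹)) ∘ₗ u.repr.toLinearMap ∘ₗ LinearMap.mulLeft F (u x) ∘ₗ
      LinearMap.mulRight F (u x⁻¹) = (Finsupp.lapply g) ∘ₗ u.repr.toLinearMap := by
    refine u.ext fun h => ?_
    simp only [LinearMap.comp_apply, LinearMap.mulLeft_apply, LinearMap.mulRight_apply, ← hu.mul,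
      LinearEquiv.coe_coe, Basis.repr_self, Finsupp.lapply_apply]
    by_cases h' : h = g
    · subst h'; simp [mul_assoc]
    · rw [Finsupp.single_eq_of_ne, Finsupp.single_eq_of_ne (Ne.symm h')]
      intro hh
      apply h'
      rw [← mul_assoc] at hh
      simpa using hh.symm
  have := congrArg (fun f => f a) hl
  simp only [LinearMap.comp_apply, LinearMap.mulLeft_apply, LinearMap.mulRight_apply] at this
  rw [(Subalgebra.mem_center_iff.1 ha (u x⁻¹)).symm, ← mul_assoc, hu.mul_inv, one_mul] at this
  exact this

theorem IsGroupBasis.basis_mem_center {u : Basis G F A} (hu : IsGroupBasis u) {z : G}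
    (hz : z ∈ Subgroup.center G) : u z ∈ Subalgebra.center F A := by
  rw [Subalgebra.mem_center_iff]
  intro b
  have : LinearMap.mulRight F (u z) = LinearMap.mulLeft F (u z) := u.ext fun g => by
    simp [← hu.mul, Subgroup.mem_center_iff.1 hz g]
  exact congrArg (fun f => f b) this

/-- The coefficients of a central element are constant on classes, so summing over a class
multiplies the coefficient by the class size. That size is divisible by p, hence zero in `F`, unless
the class is a single central element. -/
theorem classMap_center {p : ℕ} [Fact p.Prime] [CharP F p] [Finite G] (hG : IsPGroup p G)
    {u : Basis G F A} (hu : IsGroupBasis u) :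
    (Subalgebra.toSubmodule (Subalgebra.center F A)).map (classMap u) = Submodule.span F
      ((fun C => Finsupp.single C (1 : F)) '' (ConjClasses.mk '' (Subgroup.center G : Set G))) := by
  classical
  have := Fintype.ofFinite G
  apply le_antisymm
  · rintro _ ⟨a, ha, rfl⟩
    have hC : ∀ g : G, g ∉ Subgroup.center G → classMap u a (ConjClasses.mk g) = 0 := by
      intro g hg
      have h1 : classMap u a = ∑ h, u.repr a h • Finsupp.single (ConjClasses.mk h) (1 : F) := by
        conv_lhs => rw [← u.sum_repr a]
        simp only [map_sum, map_smul, classMap_basis]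
      rw [h1, Finsupp.finsetSum_apply]
      have h2 : ∀ h : G, (u.repr a h • Finsupp.single (ConjClasses.mk h) (1 : F))
          (ConjClasses.mk g) = if h ∈ (ConjClasses.mk g).carrier then u.repr a g else 0 := by
        intro h
        rw [Finsupp.smul_apply, Finsupp.single_apply, ConjClasses.mem_carrier_iff_mk_eq]
        split_ifs with hh
        · obtain ⟨x, hx⟩ := isConj_iff.1 (ConjClasses.mk_eq_mk_iff_isConj.1 hh.symm)
          rw [← hx, hu.repr_conj ha]; simp
        · simp
      rw [Finset.sum_congr rfl fun h _ => h2 h, ← Finset.sum_filter, Finset.sum_const,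
        ← Nat.cast_smul_eq_nsmul F]
      have h3 : (Finset.univ.filter fun h => h ∈ (ConjClasses.mk g).carrier).card =
          Nat.card (ConjClasses.mk g).carrier := by
        rw [Nat.card_eq_fintype_card, Fintype.card_subtype]
      rw [h3, (CharP.cast_eq_zero_iff F p _).2 (hG.dvd_card_carrier hg), zero_smul]
    rw [← Finsupp.sum_single (classMap u a)]
    refine Submodule.sum_mem _ fun C hC' => ?_
    obtain ⟨g, rfl⟩ := ConjClasses.exists_rep C
    have hg : g ∈ Subgroup.center G := by
      by_contra hg
      exact (Finsupp.mem_support_iff.1 hC') (hC g hg)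
    rw [← mul_one (classMap u a _), ← smul_eq_mul, ← Finsupp.smul_single]
    exact Submodule.smul_mem _ _ (Submodule.subset_span ⟨_, ⟨g, hg, rfl⟩, rfl⟩)
  · refine Submodule.span_le.2 ?_
    rintro _ ⟨_, ⟨z, hz, rfl⟩, rfl⟩
    exact ⟨u z, hu.basis_mem_center hz, by simp⟩

theorem conjClasses_mk_injOn_center :
    Set.InjOn ConjClasses.mk (Subgroup.center G : Set G) := by
  intro x hx y hy h
  obtain ⟨c, hc⟩ := isConj_iff.1 (ConjClasses.mk_eq_mk_iff_isConj.1 h)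
  rw [← hc, Subgroup.mem_center_iff.1 hx c, mul_inv_cancel_right]

theorem card_center_eq {p : ℕ} [Fact p.Prime] [CharP F p] [Finite G] [Finite H]
    (hG : IsPGroup p G) (hH : IsPGroup p H) {u : Basis G F A} {v : Basis H F A}
    (hu : IsGroupBasis u) (hv : IsGroupBasis v) :
    Nat.card (Subgroup.center G) = Nat.card (Subgroup.center H) := by
  have h := finrank_map_eq_of_ker_eq ((ker_classMap hu).trans (ker_classMap hv).symm)
    (Subalgebra.toSubmodule (Subalgebra.center F A))
  rw [classMap_center hG hu, classMap_center hH hv, finrank_span_range_single,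
    finrank_span_range_single, Nat.card_image_of_injOn conjClasses_mk_injOn_center,
    Nat.card_image_of_injOn conjClasses_mk_injOn_center] at h
  exact h

/-- The projection of a group algebra to the group algebra of a quotient group. -/
noncomputable def quotientMap (u : Basis G F A) (N : Subgroup G) : A →ₗ[F] (G ⧸ N →₀ F) :=
  u.constr F fun g => Finsupp.single (g : G ⧸ N) 1

@[simp] theorem quotientMap_basis (u : Basis G F A) (N : Subgroup G) (g : G) :
    quotientMap u N (u g) = Finsupp.single (g : G ⧸ N) 1 := by
  simp [quotientMap, Basis.constr_basis]

theorem quotientMap_surjective (u : Basis G F A) (N : Subgroup G) :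
    Function.Surjective (quotientMap u N) := by
  rw [← LinearMap.range_eq_top, eq_top_iff, ← Finsupp.basisSingleOne.span_eq, Submodule.span_le]
  rintro _ ⟨C, rfl⟩
  obtain ⟨g, rfl⟩ := QuotientGroup.mk_surjective C
  exact ⟨u g, by simp⟩

theorem ker_quotientMap {u : Basis G F A} (hu : IsGroupBasis u) (N : Subgroup G) :
    LinearMap.ker (quotientMap u N) = ⊤ * augSpan u N := by
  apply le_antisymm
  · let σ : (G ⧸ N →₀ F) →ₗ[F] A ⧸ (⊤ * augSpan u N) :=
      Finsupp.linearCombination F fun q => (⊤ * augSpan u N).mkQ (u (Quotient.out q))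
    have hσ : σ ∘ₗ quotientMap u N = (⊤ * augSpan u N).mkQ := by
      refine u.ext fun g => ?_
      have hc : g⁻¹ * (Quotient.out (g : G ⧸ N)) ∈ N := by
        rw [← QuotientGroup.eq]; exact (QuotientGroup.out_eq' _).symm
      simp only [σ, LinearMap.comp_apply, quotientMap_basis, Finsupp.linearCombination_single,
        one_smul]
      rw [← sub_eq_zero, ← map_sub, ← LinearMap.mem_ker, Submodule.ker_mkQ]
      have := Submodule.mul_mem_mul (show u g ∈ (⊤ : Submodule F A) from trivial)
        (sub_one_mem_augSpan u hc)
      rwa [mul_sub, ← hu.mul, mul_inv_cancel_left, mul_one] at this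
    intro a ha
    have := congrArg (fun f => f a) hσ
    rw [LinearMap.comp_apply, LinearMap.mem_ker.1 ha, map_zero] at this
    rwa [← (⊤ * augSpan u N).ker_mkQ, LinearMap.mem_ker, eq_comm]
  · refine Submodule.mul_le.2 fun a _ b hb => ?_
    have : augSpan u N ≤ (LinearMap.ker (quotientMap u N)).comap (LinearMap.mulLeft F a) := by
      refine augSpan_le.2 fun n hn => ?_
      rw [Submodule.mem_comap, LinearMap.mulLeft_apply]
      induction a using u.elim_induction with
      | zero => simp
      | add x y hx hy => rw [add_mul]; exact add_mem (hx trivial) (hy trivial)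
      | smul c x hx => rw [smul_mul_assoc]; exact Submodule.smul_mem _ _ (hx trivial)
      | coe g =>
        rw [LinearMap.mem_ker, mul_sub, ← hu.mul, mul_one, map_sub, quotientMap_basis,
          quotientMap_basis, QuotientGroup.mk_mul_of_mem g hn, sub_self]
    exact this hb

theorem mul_augSpan_le_of_closure {u : Basis G F A} (hu : IsGroupBasis u) {S : Set G}
    {V : Submodule F A} (hV : ⊤ * V ≤ V) (hS : ∀ s ∈ S, u s - 1 ∈ V) :
    ⊤ * augSpan u (Subgroup.closure S) ≤ V := by
  have hV' : ∀ a : A, ∀ v ∈ V, a * v ∈ V := fun a v hv => hV (Submodule.mul_mem_mul trivial hv)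
  refine (mul_le_mul_right (augSpan_le.2 fun n hn => ?_) _).trans hV
  induction hn using Subgroup.closure_induction with
  | mem x hx => exact hS x hx
  | one => simp [hu.one]
  | mul x y _ _ hx hy =>
    have : u (x * y) - 1 = u x * (u y - 1) + (u x - 1) := by rw [hu.mul]; noncomm_ring
    rw [this]
    exact add_mem (hV' _ _ hy) hx
  | inv x _ hx =>
    have : u x⁻¹ - 1 = (-u x⁻¹) * (u x - 1) := by
      rw [neg_mul, mul_sub, hu.inv_mul]; simp
    rw [this]
    exact hV' _ _ hx

/-- The map from conjugacy classes to the abelianization. -/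
def ConjClasses.toAbelianization (C : ConjClasses G) : G ⧸ commutator G :=
  Quotient.lift (s := IsConj.setoid G) (fun g => (g : G ⧸ commutator G)) (fun a b h => by
    obtain ⟨c, rfl⟩ := isConj_iff.1 h
    rw [QuotientGroup.eq]
    have := Subgroup.commutator_mem_commutator (Subgroup.mem_top a⁻¹) (Subgroup.mem_top c)
    change _ ∈ ⁅(⊤ : Subgroup G), ⊤⁆
    simpa [commutatorElement_def, mul_assoc] using this) C

theorem quotientMap_commutator_eq (u : Basis G F A) : quotientMap u (commutator G) =
    Finsupp.lmapDomain F F ConjClasses.toAbelianization ∘ₗ classMap u := by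
  refine u.ext fun g => ?_
  rw [LinearMap.comp_apply, classMap_basis, Finsupp.lmapDomain_apply, Finsupp.mapDomain_single,
    quotientMap_basis]
  rfl

/-- `u ⁅x, y⁆ - 1` is a left multiple of the additive commutator of `u x⁻¹` and `u y⁻¹`; conversely,
the map to the group algebra of the abelianization kills additive commutators. The right-hand side
names no group. -/
theorem top_mul_augSpan_commutator {u : Basis G F A} (hu : IsGroupBasis u) :
    ⊤ * augSpan u (commutator G) = ⊤ * commutatorSpan F A := by
  apply le_antisymm
  · rw [commutator_eq_closure]
    refine mul_augSpan_le_of_closure hu ?_ ?_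
    · rw [← mul_assoc]
      exact Submodule.mul_le.2 fun a _ b hb => Submodule.mul_mem_mul trivial hb
    · rintro _ ⟨x, y, rfl⟩
      have : u ⁅x, y⁆ - 1 = u (x * y) * (u x⁻¹ * u y⁻¹ - u y⁻¹ * u x⁻¹) := by
        rw [mul_sub, ← hu.mul, ← hu.mul, ← hu.mul, ← hu.mul, commutatorElement_def, ← mul_assoc]
        congr 1
        rw [← mul_inv_rev, mul_inv_cancel, hu.one]
      rw [this]
      exact Submodule.mul_mem_mul trivial (commutator_mem_commutatorSpan _ _)
  · have h1 : commutatorSpan F A ≤ ⊤ * augSpan u (commutator G) := by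
      rw [← ker_classMap hu, ← ker_quotientMap hu, quotientMap_commutator_eq]
      exact LinearMap.ker_le_ker_comp _ _
    refine (mul_le_mul_right h1 _).trans ?_
    rw [← mul_assoc]
    exact Submodule.mul_le.2 fun a _ b hb => Submodule.mul_mem_mul trivial hb

theorem finrank_map_quotientMap_top (u : Basis G F A) (N : Subgroup G) [Finite G] :
    finrank F ((⊤ : Submodule F A).map (quotientMap u N)) = N.index := by
  rw [Submodule.map_top, LinearMap.range_eq_top.2 (quotientMap_surjective u N), finrank_top]
  have := Fintype.ofFinite (G ⧸ N)
  simp [Subgroup.index]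

theorem ker_quotientMap_commutator_eq {u : Basis G F A} {v : Basis H F A}
    (hu : IsGroupBasis u) (hv : IsGroupBasis v) :
    LinearMap.ker (quotientMap u (commutator G)) = LinearMap.ker (quotientMap v (commutator H)) := by
  rw [ker_quotientMap hu, ker_quotientMap hv, top_mul_augSpan_commutator hu,
    top_mul_augSpan_commutator hv]

theorem index_commutator_eq [Finite G] [Finite H] {u : Basis G F A} {v : Basis H F A}
    (hu : IsGroupBasis u) (hv : IsGroupBasis v) :
    (commutator G).index = (commutator H).index := by
  rw [← finrank_map_quotientMap_top u, ← finrank_map_quotientMap_top v]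
  exact finrank_map_eq_of_ker_eq (ker_quotientMap_commutator_eq hu hv) _

omit [Group G] [Group H] in
theorem card_group_eq {u : Basis G F A} (v : Basis H F A) : Nat.card G = Nat.card H :=
  Nat.card_congr (u.indexEquiv v)

theorem card_commutator_eq [Finite G] [Finite H] {u : Basis G F A} {v : Basis H F A}
    (hu : IsGroupBasis u) (hv : IsGroupBasis v) :
    Nat.card (commutator G) = Nat.card (commutator H) := by
  have h := (commutator G).card_mul_index
  rw [card_group_eq (u := u) v, ← (commutator H).card_mul_index, index_commutator_eq hu hv] at h
  exact Nat.eq_of_mul_eq_mul_right (Nat.pos_of_ne_zero Subgroup.index_ne_zero_of_finite) h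

theorem quotientMap_center {p : ℕ} [Fact p.Prime] [CharP F p] [Finite G] (hG : IsPGroup p G)
    {u : Basis G F A} (hu : IsGroupBasis u) :
    (Subalgebra.toSubmodule (Subalgebra.center F A)).map (quotientMap u (commutator G)) =
      Submodule.span F ((fun C => Finsupp.single C (1 : F)) ''
        ((Subgroup.center G).map (QuotientGroup.mk' (commutator G)) : Set (G ⧸ commutator G))) := by
  rw [quotientMap_commutator_eq, Submodule.map_comp, classMap_center hG hu, Submodule.map_span,
    Set.image_image, Set.image_image, Subgroup.coe_map, Set.image_image]
  congr 1
  refine Set.image_congr fun z _ => ?_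
  rw [Finsupp.lmapDomain_apply, Finsupp.mapDomain_single]
  rfl

theorem card_center_inf_commutator_mul {G : Type*} [Group G] :
    Nat.card ((Subgroup.center G).map (QuotientGroup.mk' (commutator G))) *
      Nat.card (Subgroup.center G ⊓ commutator G : Subgroup G) = Nat.card (Subgroup.center G) := by
  have h := Subgroup.card_mul_index
    ((QuotientGroup.mk' (commutator G)).comp (Subgroup.center G).subtype).ker
  rw [Subgroup.index_ker, mul_comm] at h
  rw [← h]
  congr 1
  · rw [MonoidHom.range_comp, Subgroup.range_subtype]
  · rw [← MonoidHom.comap_ker, QuotientGroup.ker_mk', ← Subgroup.subgroupOf, inf_comm]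
    exact Nat.card_congr
      (Subgroup.subgroupOfEquivOfLe (inf_le_right : commutator G ⊓ _ ≤ _)).symm.toEquiv |>.trans
      (by rw [Subgroup.inf_subgroupOf_right])

/-- The image of the centre of `A` modulo the ideal generated by commutators has dimension
|Z(G)G'/G'|. Dividing |Z(G)| by it gives |Z(G) ∩ G'|. -/
theorem card_center_inf_commutator_eq {p : ℕ} [Fact p.Prime] [CharP F p] [Finite G] [Finite H]
    (hG : IsPGroup p G) (hH : IsPGroup p H) {u : Basis G F A} {v : Basis H F A}
    (hu : IsGroupBasis u) (hv : IsGroupBasis v) :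
    Nat.card (Subgroup.center G ⊓ commutator G : Subgroup G) =
      Nat.card (Subgroup.center H ⊓ commutator H : Subgroup H) := by
  have h := finrank_map_eq_of_ker_eq (ker_quotientMap_commutator_eq hu hv)
    (Subalgebra.toSubmodule (Subalgebra.center F A))
  rw [quotientMap_center hG hu, quotientMap_center hH hv, finrank_span_range_single,
    finrank_span_range_single, SetLike.coe_sort_coe, SetLike.coe_sort_coe] at h
  have h1 := card_center_inf_commutator_mul (G := G)
  rw [card_center_eq hG hH hu hv, ← card_center_inf_commutator_mul (G := H), h] at h1
  exact Nat.eq_of_mul_eq_mul_left Nat.card_pos h1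

end GroupBasisInvariants

/-! ### Cyclicity read off from the nilpotency index -/

section CyclicCriterion

open Module
open scoped commutatorElement

variable {F A G H : Type*} [Field F] [Ring A] [Algebra F A] [Group G] [Group H]

theorem finrank_augSpan_top [Finite G] {u : Basis G F A} (hu : IsGroupBasis u) :
    finrank F (augSpan u ⊤) + 1 = Nat.card G := by
  have := Module.Finite.of_basis u
  have h := (augmentation u).finrank_range_add_finrank_ker
  have h1 : LinearMap.ker (augmentation u) = augSpan u ⊤ := by
    ext a; rw [mem_augSpan_top_iff hu, LinearMap.mem_ker]
  have h2 : LinearMap.range (augmentation u) = ⊤ :=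
    LinearMap.range_eq_top.2 fun c => ⟨c • u 1, by simp⟩
  rw [h1, h2, finrank_top, finrank_self, finrank_eq_nat_card_basis u] at h
  omega

theorem Submodule.pow_succ_lt_of_nilpotent {I : Submodule F A} (hI : I * I ≤ I) {N : ℕ}
    (hN : I ^ N = ⊥) {k : ℕ} (hk : 1 ≤ k) (h : I ^ k ≠ ⊥) : I ^ (k + 1) < I ^ k := by
  have hle : I ^ (k + 1) ≤ I ^ k := by
    obtain ⟨j, rfl⟩ := Nat.exists_eq_add_of_le' hk
    rw [pow_succ, pow_succ, mul_assoc]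
    exact mul_le_mul_right hI _
  refine lt_of_le_of_ne hle fun he => h ?_
  have : ∀ j, I ^ (k + j) = I ^ k := by
    intro j
    induction j with
    | zero => rfl
    | succ j ih => rw [← add_assoc, pow_succ, ih, ← pow_succ, he]
  rw [← this N, pow_add, hN, Submodule.mul_bot]

theorem Submodule.finrank_pow_add_le [Module.Finite F A] {I : Submodule F A} (hI : I * I ≤ I)
    {N : ℕ} (hN : I ^ N = ⊥) {k : ℕ} (hk : 1 ≤ k) (j : ℕ) (h : I ^ (k + j) ≠ ⊥) :
    finrank F (I ^ (k + j) : Submodule F A) + j ≤ finrank F (I ^ k : Submodule F A) := by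
  induction j with
  | zero => simp
  | succ j ih =>
    have hne : I ^ (k + j) ≠ ⊥ := fun h0 => h (by
      rw [← add_assoc, pow_succ, h0, Submodule.bot_mul])
    have h1 := ih hne
    have h2 := Submodule.finrank_lt_finrank_of_lt
      (Submodule.pow_succ_lt_of_nilpotent hI hN (by omega) hne)
    rw [← add_assoc k j 1]
    omega

theorem augSpan_top_mul_self_le {u : Basis G F A} (hu : IsGroupBasis u) :
    augSpan u ⊤ * augSpan u ⊤ ≤ augSpan u ⊤ :=
  Submodule.mul_le.2 fun a _ _ hb => mul_mem_augSpan_top hu a hb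

/-- With y = `u x - 1` and I the augmentation ideal, I^k lies in F y^k + I^(k+1) for every k ≥ 1. As
I is nilpotent, it is contained in the span of the basis elements indexed by powers of `x`, and
linear independence forces every group element to be such a power. -/
theorem isCyclic_of_augSpan_top_le [Finite G] {p : ℕ} [Fact p.Prime] [CharP F p]
    (hG : IsPGroup p G) {u : Basis G F A} (hu : IsGroupBasis u) (x : G)
    (hx : augSpan u ⊤ ≤ F ∙ (u x - 1) ⊔ augSpan u ⊤ ^ 2) : IsCyclic G := by
  set I := augSpan u ⊤ with hIdef
  obtain ⟨N, hN⟩ := hG.augSpan_top_pow_eq_bot hu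
  have hpow : ∀ k, 1 ≤ k → I ^ k ≤ F ∙ ((u x - 1) ^ k) ⊔ I ^ (k + 1) := by
    intro k hk
    induction k, hk using Nat.le_induction with
    | base => simpa using hx
    | succ k hk ih =>
      rw [pow_succ]
      refine (mul_le_mul' ih hx).trans ?_
      rw [Submodule.sup_mul, Submodule.mul_sup, Submodule.mul_sup]
      have hy : F ∙ (u x - 1) ≤ I := by
        rw [Submodule.span_singleton_le_iff_mem]
        exact sub_one_mem_augSpan u (Subgroup.mem_top x)
      have hyk : F ∙ ((u x - 1) ^ k) ≤ I ^ k := by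
        rw [Submodule.span_singleton_le_iff_mem]
        exact Submodule.pow_mem_pow _ (hy (Submodule.mem_span_singleton_self _)) k
      refine sup_le (sup_le ?_ ?_) (sup_le ?_ ?_)
      · rw [Submodule.span_mul_span, Set.singleton_mul_singleton, ← pow_succ]
        exact le_sup_left
      · refine le_trans ?_ le_sup_right
        rw [show k + 1 + 1 = k + 2 from rfl, pow_add]
        exact mul_le_mul_left hyk _
      · refine le_trans ?_ le_sup_right
        rw [pow_succ I (k + 1)]
        exact mul_le_mul_right hy _
      · refine le_trans ?_ le_sup_right
        rw [← pow_add, show k + 1 + 2 = (k + 1) + 1 + 1 from rfl, pow_succ _ (k + 1 + 1), pow_succ _ (k + 1),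
          mul_assoc]
        exact mul_le_mul_right (augSpan_top_mul_self_le hu) _
  let S : Submodule F A := Submodule.span F (u '' (Subgroup.zpowers x : Set G))
  have hS1 : (1 : A) ∈ S := hu.one ▸ Submodule.subset_span ⟨1, one_mem _, rfl⟩
  have hSx : u x - 1 ∈ S :=
    sub_mem (Submodule.subset_span ⟨x, Subgroup.mem_zpowers x, rfl⟩) hS1
  have hSS : S * S ≤ S := by
    rw [Submodule.span_mul_span, Submodule.span_le]
    rintro _ ⟨_, ⟨a, ha, rfl⟩, _, ⟨b, hb, rfl⟩, rfl⟩
    exact Submodule.subset_span ⟨a * b, mul_mem ha hb, hu.mul a b⟩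
  have hSk : ∀ k, (u x - 1) ^ k ∈ S := by
    intro k
    induction k with
    | zero => simpa using hS1
    | succ k ih => rw [pow_succ]; exact hSS (Submodule.mul_mem_mul ih hSx)
  have hIS : ∀ k, 1 ≤ k → I ≤ S ⊔ I ^ k := by
    intro k hk
    induction k, hk using Nat.le_induction with
    | base => simp
    | succ k hk ih =>
      refine ih.trans (sup_le le_sup_left ((hpow k hk).trans (sup_le_sup_right ?_ _)))
      rw [Submodule.span_singleton_le_iff_mem]
      exact hSk k
  have hI : I ≤ S := by
    have := hIS (N + 1) (by omega)
    rwa [pow_succ, hN, Submodule.bot_mul, sup_bot_eq] at this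
  refine ⟨x, fun g => ?_⟩
  by_contra hg
  refine u.linearIndependent.notMem_span_image (s := Subgroup.zpowers x) (x := g) hg ?_
  have := add_mem (hI (sub_one_mem_augSpan u (Subgroup.mem_top g))) hS1
  rwa [sub_add_cancel] at this

/-- The powers of I decrease strictly until they vanish, and dim I = |G| - 1. If I^(|G|-1) is
nonzero, every drop has dimension one, in particular the one from I to I². -/
theorem isCyclic_of_augSpan_top_pow_ne_bot [Finite G] {p : ℕ} [Fact p.Prime] [CharP F p]
    (hG : IsPGroup p G) {u : Basis G F A} (hu : IsGroupBasis u)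
    (h : augSpan u ⊤ ^ (Nat.card G - 1) ≠ ⊥) : IsCyclic G := by
  have hfin := Module.Finite.of_basis u
  obtain ⟨N, hN⟩ := hG.augSpan_top_pow_eq_bot hu
  have hI := augSpan_top_mul_self_le hu
  rcases subsingleton_or_nontrivial G with hs | hnt
  · exact isCyclic_of_subsingleton
  have hcard := finrank_augSpan_top hu
  have h1 : 1 < Nat.card G := Finite.one_lt_card
  have hne : ∀ k ≤ Nat.card G - 1, augSpan u ⊤ ^ k ≠ ⊥ := by
    intro k hk h0
    obtain ⟨j, hj⟩ := Nat.exists_eq_add_of_le hk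
    rw [hj, pow_add, h0, Submodule.bot_mul] at h
    exact h rfl
  have hlt := Submodule.pow_succ_lt_of_nilpotent hI hN le_rfl (hne 1 (by omega))
  rw [pow_one] at hlt
  have hfr : finrank F (augSpan u ⊤) ≤
      finrank F (augSpan u ⊤ ^ 2 : Submodule F A) + 1 := by
    by_contra hcon
    rcases Nat.lt_or_ge (Nat.card G) 3 with hc | hc
    · omega
    have h2 := Submodule.finrank_pow_add_le hI hN (k := 2) (by norm_num) (Nat.card G - 3)
      (by rw [show 2 + (Nat.card G - 3) = Nat.card G - 1 by omega]; exact h)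
    have h3 : 0 < finrank F (augSpan u ⊤ ^ (2 + (Nat.card G - 3)) : Submodule F A) := by
      rw [show 2 + (Nat.card G - 3) = Nat.card G - 1 by omega]
      exact Nat.pos_of_ne_zero fun h0 => h (Submodule.finrank_eq_zero.1 h0)
    omega
  obtain ⟨x, hx⟩ : ∃ x, u x - 1 ∉ augSpan u ⊤ ^ 2 := by
    by_contra! hcon
    exact hlt.not_ge (augSpan_le.2 fun n _ => hcon n)
  refine isCyclic_of_augSpan_top_le hG hu x (ge_of_eq ?_)
  have hle : F ∙ (u x - 1) ⊔ augSpan u ⊤ ^ 2 ≤ augSpan u ⊤ := by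
    refine sup_le ?_ hlt.le
    rw [Submodule.span_singleton_le_iff_mem]
    exact sub_one_mem_augSpan u (Subgroup.mem_top x)
  refine Submodule.eq_of_le_of_finrank_le hle (hfr.trans ?_)
  refine Submodule.finrank_lt_finrank_of_lt (lt_of_le_of_ne le_sup_right fun he => hx ?_)
  rw [he]
  exact Submodule.mem_sup_left (Submodule.mem_span_singleton_self _)

/-- Modulo lower powers of the generator, `(u x - 1) ^ n` is `u (x ^ n)`. For n = |G| - 1 these
powers are distinct, so the element is nonzero. -/
theorem augSpan_top_pow_ne_bot_of_isCyclic [Finite G] {u : Basis G F A} (hu : IsGroupBasis u)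
    (hc : IsCyclic G) : augSpan u ⊤ ^ (Nat.card G - 1) ≠ ⊥ := by
  obtain ⟨x, hx⟩ := hc
  have hord : orderOf x = Nat.card G := orderOf_eq_card_of_forall_mem_zpowers hx
  have key : ∀ n, (u x - 1) ^ n - u (x ^ n) ∈
      Submodule.span F (u '' ((fun i => x ^ i) '' Set.Iio n)) := by
    intro n
    induction n with
    | zero => simp [hu.one]
    | succ n ih =>
      have e : (u x - 1) ^ (n + 1) - u (x ^ (n + 1)) =
          ((u x - 1) ^ n - u (x ^ n)) * (u x - 1) - u (x ^ n) := by
        rw [pow_succ x n, hu.mul, pow_succ (u x - 1) n]; noncomm_ring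
      have hle : Submodule.span F (u '' ((fun i => x ^ i) '' Set.Iio n)) ≤
          (Submodule.span F (u '' ((fun i => x ^ i) '' Set.Iio (n + 1)))).comap
            (LinearMap.mulRight F (u x - 1)) := by
        rw [Submodule.span_le]
        rintro _ ⟨_, ⟨i, hi, rfl⟩, rfl⟩
        have hi' : i < n := hi
        rw [SetLike.mem_coe, Submodule.mem_comap, LinearMap.mulRight_apply, mul_sub, mul_one,
          ← hu.mul, ← pow_succ]
        refine sub_mem (Submodule.subset_span ⟨_, ⟨i + 1, ?_, rfl⟩, rfl⟩)
          (Submodule.subset_span ⟨_, ⟨i, ?_, rfl⟩, rfl⟩)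
        · exact Set.mem_Iio.2 (by omega)
        · exact Set.mem_Iio.2 (by omega)
      rw [e]
      exact sub_mem (hle ih) (Submodule.subset_span ⟨_, ⟨n, Set.mem_Iio.2 (by omega), rfl⟩, rfl⟩)
  intro h
  have h0 : (u x - 1) ^ (Nat.card G - 1) = 0 := by
    rw [← Submodule.mem_bot F, ← h]
    exact Submodule.pow_mem_pow _ (sub_one_mem_augSpan u (Subgroup.mem_top x)) _
  have h1 := key (Nat.card G - 1)
  rw [h0, zero_sub, neg_mem_iff] at h1
  refine u.linearIndependent.notMem_span_image ?_ h1
  rintro ⟨i, hi, he⟩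
  have hi' : i < Nat.card G - 1 := hi
  have := pow_injOn_Iio_orderOf (x := x) (Set.mem_Iio.2 (by omega)) (Set.mem_Iio.2
    (by have := Nat.card_pos (α := G); omega)) he
  omega

theorem isCyclic_iff_augSpan_top_pow_ne_bot [Finite G] {p : ℕ} [Fact p.Prime] [CharP F p]
    (hG : IsPGroup p G) {u : Basis G F A} (hu : IsGroupBasis u) :
    IsCyclic G ↔ augSpan u ⊤ ^ (Nat.card G - 1) ≠ ⊥ :=
  ⟨augSpan_top_pow_ne_bot_of_isCyclic hu, isCyclic_of_augSpan_top_pow_ne_bot hG hu⟩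

theorem MonoidAlgebra.isGroupBasis : IsGroupBasis (MonoidAlgebra.basis G F) := fun g h => by
  simp [MonoidAlgebra.single_mul_single]

/-- The group algebra of `N` embeds in `A`, and its augmentation ideal maps onto `augSpan u N`. -/
theorem augSpan_pow_eq_bot_iff {u : Basis G F A} (hu : IsGroupBasis u) (N : Subgroup G) (k : ℕ) :
    augSpan u N ^ k = ⊥ ↔ augSpan (MonoidAlgebra.basis N F) ⊤ ^ k = ⊥ := by
  let f : N →* A := ⟨⟨fun n => u n, hu.one⟩, fun a b => hu.mul a b⟩
  let φ : MonoidAlgebra F N →ₐ[F] A := MonoidAlgebra.lift F A N f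
  have hφ : ∀ n : N, φ (MonoidAlgebra.basis N F n) = u n := fun n => by simp [φ, f]
  have hinj : Function.Injective φ.toLinearMap := by
    have hli : LinearIndependent F fun n : N => u n :=
      u.linearIndependent.comp _ Subtype.val_injective
    have e : φ.toLinearMap = Finsupp.linearCombination F (fun n : N => u n) ∘ₗ
        (MonoidAlgebra.basis N F).repr.toLinearMap :=
      (MonoidAlgebra.basis N F).ext fun n => by
        rw [LinearMap.comp_apply, LinearEquiv.coe_coe, Basis.repr_self,
          Finsupp.linearCombination_single, one_smul]
        exact hφ n
    rw [e, LinearMap.coe_comp]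
    exact Function.Injective.comp hli (MonoidAlgebra.basis N F).repr.injective
  have hmap : (augSpan (MonoidAlgebra.basis N F) ⊤).map φ.toLinearMap = augSpan u N := by
    rw [augSpan, augSpan, Submodule.map_span, Set.image_image]
    congr 1
    have hφ' : ∀ n : N, φ.toLinearMap (MonoidAlgebra.basis N F n - 1) = u n - 1 := fun n => by
      rw [map_sub, AlgHom.toLinearMap_apply, AlgHom.toLinearMap_apply, hφ, map_one]
    simp only [hφ']
    ext a
    simp
  rw [← hmap, ← Submodule.map_pow]
  exact ⟨fun h => Submodule.map_injective_of_injective hinj (h.trans (Submodule.map_bot _).symm),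
    fun h => by rw [h, Submodule.map_bot]⟩

/-- Normality allows factors from `A` to be moved to the left past `augSpan u N`, so a power of the
left multiple is contained in `A` times the power of `augSpan u N`. -/
theorem top_mul_augSpan_pow_eq_bot_iff {u : Basis G F A} (hu : IsGroupBasis u) (N : Subgroup G)
    [N.Normal] (k : ℕ) : (⊤ * augSpan u N) ^ k = ⊥ ↔ augSpan u N ^ k = ⊥ := by
  have h1 : augSpan u N * ⊤ ≤ ⊤ * augSpan u N := by
    rw [augSpan, ← u.span_eq, Submodule.span_mul_span, Submodule.span_le]
    rintro _ ⟨_, ⟨n, hn, rfl⟩, _, ⟨g, rfl⟩, rfl⟩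
    have hg : g⁻¹ * n * g ∈ N := by
      simpa using ‹N.Normal›.conj_mem n hn g⁻¹
    have e : (u n - 1) * u g = u g * (u (g⁻¹ * n * g) - 1) := by
      rw [sub_mul, mul_sub, ← hu.mul, ← hu.mul, one_mul, mul_one]
      congr 2; group
    change (u n - 1) * u g ∈ _
    rw [e]
    exact Submodule.mul_mem_mul (Submodule.subset_span ⟨g, rfl⟩)
      (Submodule.subset_span ⟨_, hg, rfl⟩)
  have h2 : ∀ j, augSpan u N ^ j * ⊤ ≤ ⊤ * augSpan u N ^ j := by
    intro j
    induction j with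
    | zero => simp
    | succ j ih =>
      rw [pow_succ, mul_assoc]
      refine (mul_le_mul_right h1 _).trans ?_
      rw [← mul_assoc, ← mul_assoc]
      exact mul_le_mul_left ih _
  have htt : (⊤ : Submodule F A) * ⊤ ≤ ⊤ := le_top
  have h3 : (⊤ * augSpan u N) ^ k ≤ ⊤ * augSpan u N ^ k := by
    induction k with
    | zero => simp
    | succ k ih =>
      rw [pow_succ, pow_succ]
      refine (mul_le_mul_left ih _).trans ?_
      rw [mul_assoc, ← mul_assoc (augSpan u N ^ k)]
      refine (mul_le_mul_right (mul_le_mul_left (h2 k) _) _).trans ?_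
      rw [← mul_assoc, ← mul_assoc, mul_assoc]
      exact mul_le_mul_left htt _
  constructor
  · intro h
    rw [eq_bot_iff, ← h]
    exact pow_le_pow_left' (fun x hx => by
      simpa using Submodule.mul_mem_mul (show (1 : A) ∈ (⊤ : Submodule F A) from trivial) hx) k
  · intro h
    rw [eq_bot_iff]
    refine h3.trans ?_
    rw [h, Submodule.mul_bot]

theorem isCyclic_commutator_of_isCyclic_commutator [Finite G] [Finite H] {p : ℕ} [Fact p.Prime]
    [CharP F p] (hH : IsPGroup p H) {u : Basis G F A} {v : Basis H F A}
    (hu : IsGroupBasis u) (hv : IsGroupBasis v) (h : IsCyclic (commutator G)) :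
    IsCyclic (commutator H) := by
  rw [isCyclic_iff_augSpan_top_pow_ne_bot (hH.to_subgroup _) (MonoidAlgebra.isGroupBasis (F := F)),
    Ne, ← augSpan_pow_eq_bot_iff hv, ← top_mul_augSpan_pow_eq_bot_iff hv,
    top_mul_augSpan_commutator hv, ← card_commutator_eq hu hv, ← top_mul_augSpan_commutator hu,
    top_mul_augSpan_pow_eq_bot_iff hu, augSpan_pow_eq_bot_iff hu]
  exact augSpan_top_pow_ne_bot_of_isCyclic MonoidAlgebra.isGroupBasis h

end CyclicCriterion

/-! ### Lower central series when the commutator subgroup is cyclic or central -/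

section NilpotentGroups

open Module
open scoped commutatorElement

variable {G H : Type*} [Group G] [Group H]

open Subgroup

theorem nilpotencyClass_eq_of_card_lowerCentralSeries_eq [Group.IsNilpotent G]
    [Group.IsNilpotent H]
    (h : ∀ n, Nat.card ((⊤ : Subgroup G).lowerCentralSeries n) =
      Nat.card ((⊤ : Subgroup H).lowerCentralSeries n)) :
    Group.nilpotencyClass H = Group.nilpotencyClass G := by
  have key : ∀ n, Group.nilpotencyClass G ≤ n ↔ Group.nilpotencyClass H ≤ n := fun n => by
    rw [← Subgroup.lowerCentralSeries_eq_bot_iff_nilpotencyClass_le,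
      ← Subgroup.lowerCentralSeries_eq_bot_iff_nilpotencyClass_le, ← Subgroup.card_eq_one,
      ← Subgroup.card_eq_one, h n]
  exact le_antisymm ((key _).1 le_rfl) ((key _).2 le_rfl)

/-- The homomorphism `n ↦ ⁅n, g⁆` on a normal abelian subgroup. -/
def commutatorHom (N : Subgroup G) [N.Normal] (hN : ∀ a ∈ N, ∀ b ∈ N, a * b = b * a) (g : G) :
    N →* G :=
  MonoidHom.mk' (fun n => ⁅(n : G), g⁆) (by
    intro a b
    have h1 : (g * (a : G)⁻¹ * g⁻¹) ∈ N := ‹N.Normal›.conj_mem _ (inv_mem a.2) g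
    have h2 : (b : G) * (g * (b : G)⁻¹ * g⁻¹) ∈ N :=
      mul_mem b.2 (‹N.Normal›.conj_mem _ (inv_mem b.2) g)
    have h3 := hN _ h2 _ h1
    simp only [commutatorElement_def, Subgroup.coe_mul, mul_inv_rev]
    calc (a : G) * b * g * ((b : G)⁻¹ * (a : G)⁻¹) * g⁻¹
        = a * (((b : G) * (g * (b : G)⁻¹ * g⁻¹)) * (g * (a : G)⁻¹ * g⁻¹)) := by group
      _ = a * ((g * (a : G)⁻¹ * g⁻¹) * ((b : G) * (g * (b : G)⁻¹ * g⁻¹))) := by rw [h3]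
      _ = _ := by group)

theorem commutatorHom_apply (N : Subgroup G) [N.Normal] (hN : ∀ a ∈ N, ∀ b ∈ N, a * b = b * a)
    (g : G) (n : N) : commutatorHom N hN g n = ⁅(n : G), g⁆ := rfl

theorem card_ker_mul_card_range {K : Type*} [Group K] (f : G →* K) :
    Nat.card f.ker * Nat.card f.range = Nat.card G := by
  rw [← Subgroup.index_ker, Subgroup.card_mul_index]

/-- If a single element `g` has the same centralizer in the normal abelian subgroup `N` as the whole
group, and every commutator of `N` with `G` is a commutator with `g`, then `N / (N ∩ Z(G))` and
`[N, G]` have the same order. -/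
theorem card_inf_center_mul_card_commutator (N : Subgroup G) [N.Normal]
    (hN : ∀ a ∈ N, ∀ b ∈ N, a * b = b * a) (g : G)
    (hc : ∀ n ∈ N, ⁅n, g⁆ = 1 → n ∈ center G)
    (hr : ∀ n ∈ N, ∀ h, ∃ m ∈ N, ⁅m, g⁆ = ⁅n, h⁆) :
    Nat.card (N ⊓ center G : Subgroup G) * Nat.card ↥⁅N, (⊤ : Subgroup G)⁆ = Nat.card N := by
  rw [← card_ker_mul_card_range (commutatorHom N hN g)]
  congr 1
  · have : (commutatorHom N hN g).ker.map N.subtype = N ⊓ center G := by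
      ext x
      constructor
      · rintro ⟨n, hn, rfl⟩
        exact ⟨n.2, hc n n.2 hn⟩
      · rintro ⟨hx, hx'⟩
        refine ⟨⟨x, hx⟩, ?_, rfl⟩
        exact commutatorElement_eq_one_iff_mul_comm.2 (mem_center_iff.1 hx' g).symm
    rw [← this]
    exact Nat.card_congr (Subgroup.equivMapOfInjective _ _ N.subtype_injective).toEquiv.symm
  · have : (commutatorHom N hN g).range = ⁅N, (⊤ : Subgroup G)⁆ := by
      apply le_antisymm
      · rintro _ ⟨n, rfl⟩
        exact commutator_mem_commutator n.2 (mem_top g)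
      · refine commutator_le.2 fun n hn h _ => ?_
        obtain ⟨m, hm, e⟩ := hr n hn h
        exact ⟨⟨m, hm⟩, e⟩
    rw [this]

/-- In a cyclic group at most |L| elements satisfy x^|L| = 1, so `L` is the set of all of them in
`C`. For p-subgroups |K| ≤ |L| means |K| divides |L|, so `K` consists of such elements. -/
theorem IsCyclic.le_of_card_le {p : ℕ} [Fact p.Prime] [Finite G] (hG : IsPGroup p G)
    {C K L : Subgroup G} (hC : IsCyclic C) (hK : K ≤ C) (hL : L ≤ C)
    (h : Nat.card K ≤ Nat.card L) : K ≤ L := by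
  classical
  have hfin := Fintype.ofFinite C
  obtain ⟨k, hk⟩ := IsPGroup.iff_card.1 (hG.to_subgroup K)
  obtain ⟨l, hl⟩ := IsPGroup.iff_card.1 (hG.to_subgroup L)
  have hkl : k ≤ l := by
    rw [hk, hl] at h
    exact (Nat.pow_le_pow_iff_right (Fact.out : p.Prime).one_lt).1 h
  have hdvd : Nat.card K ∣ Nat.card L := by rw [hk, hl]; exact pow_dvd_pow p hkl
  have hsub : (Finset.univ.filter fun x : C => (x : G) ∈ L) ⊆
      Finset.univ.filter fun x : C => x ^ Nat.card L = 1 := by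
    intro x hx
    simp only [Finset.mem_filter, Finset.mem_univ, true_and] at hx ⊢
    have := pow_card_eq_one' (x := (⟨x, hx⟩ : L))
    have h' : (x : G) ^ Nat.card L = 1 := congrArg Subtype.val this
    ext
    simpa using h'
  have hcardL : (Finset.univ.filter fun x : C => (x : G) ∈ L).card = Nat.card L := by
    rw [← Nat.card_congr (Subgroup.subgroupOfEquivOfLe hL).toEquiv, ← Fintype.card_subtype,
      Nat.card_eq_fintype_card]
    exact Fintype.card_congr (Equiv.refl _)
  have heq := Finset.eq_of_subset_of_card_le hsub (by
    rw [hcardL]; exact IsCyclic.card_pow_eq_one_le Nat.card_pos)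
  intro x hx
  have hxm : (⟨x, hK hx⟩ : C) ∈ Finset.univ.filter fun x : C => x ^ Nat.card L = 1 := by
    simp only [Finset.mem_filter, Finset.mem_univ, true_and]
    have h1 := pow_card_eq_one' (x := (⟨x, hx⟩ : K))
    obtain ⟨d, hd⟩ := hdvd
    ext
    have h2 : x ^ Nat.card K = 1 := congrArg Subtype.val h1
    simp [hd, pow_mul, h2]
  rw [← heq] at hxm
  simpa using hxm

/-- Choose `g` for which n ↦ ⁅n, g⁆ has the largest image on `N`, hence the smallest kernel. All
these images and kernels lie in `C`, whose subgroups form a chain, so the image contains every other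
image and the kernel is contained in every other kernel. -/
theorem card_inf_center_mul_card_commutator_of_isCyclic {p : ℕ} [Fact p.Prime] [Finite G]
    (hG : IsPGroup p G) {C : Subgroup G} (hC : IsCyclic C) (N : Subgroup G) [N.Normal]
    (hNC : N ≤ C) :
    Nat.card (N ⊓ center G : Subgroup G) * Nat.card ↥⁅N, (⊤ : Subgroup G)⁆ = Nat.card N := by
  have hN : ∀ a ∈ N, ∀ b ∈ N, a * b = b * a := fun a ha b hb => by
    have := IsCyclic.commGroup (α := C) |>.mul_comm ⟨a, hNC ha⟩ ⟨b, hNC hb⟩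
    exact congrArg Subtype.val this
  obtain ⟨g, hg⟩ := Finite.exists_max fun g => Nat.card (commutatorHom N hN g).range
  have hle : ∀ h, (commutatorHom N hN h).range ≤ C := by
    rintro h _ ⟨n, rfl⟩
    exact hNC (commutator_le_left N ⊤ (commutator_mem_commutator n.2 (mem_top h)))
  have hker : ∀ h, (commutatorHom N hN g).ker.map N.subtype ≤
      (commutatorHom N hN h).ker.map N.subtype := by
    intro h
    refine IsCyclic.le_of_card_le hG hC ((map_subtype_le _).trans hNC)
      ((map_subtype_le _).trans hNC) ?_
    rw [← Nat.card_congr (Subgroup.equivMapOfInjective _ _ N.subtype_injective).toEquiv,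
      ← Nat.card_congr (Subgroup.equivMapOfInjective _ _ N.subtype_injective).toEquiv]
    have h1 := card_ker_mul_card_range (commutatorHom N hN g)
    rw [← card_ker_mul_card_range (commutatorHom N hN h)] at h1
    have h2 := hg h
    have h3 : 0 < Nat.card (commutatorHom N hN g).range := Nat.card_pos
    by_contra hcon
    push Not at hcon
    have := Nat.mul_lt_mul_of_lt_of_le hcon h2 (by exact Nat.card_pos)
    omega
  refine card_inf_center_mul_card_commutator N hN g (fun n hn h1 => ?_) fun n hn h => ?_
  · rw [mem_center_iff]
    intro h
    obtain ⟨m, hm, rfl⟩ := hker h ⟨⟨n, hn⟩, h1, rfl⟩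
    exact (commutatorElement_eq_one_iff_mul_comm.1 hm).symm
  · obtain ⟨m, hm⟩ := IsCyclic.le_of_card_le hG hC (hle h) (hle g) (hg h) ⟨⟨n, hn⟩, rfl⟩
    exact ⟨m, m.2, hm⟩

theorem card_inf_eq_min_of_isCyclic {p : ℕ} [Fact p.Prime] [Finite G] (hG : IsPGroup p G)
    {C K L : Subgroup G} (hC : IsCyclic C) (hK : K ≤ C) (hL : L ≤ C) :
    Nat.card (K ⊓ L : Subgroup G) = min (Nat.card K) (Nat.card L) := by
  rcases le_total (Nat.card K) (Nat.card L) with h | h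
  · rw [min_eq_left h, inf_eq_left.2 (IsCyclic.le_of_card_le hG hC hK hL h)]
  · rw [min_eq_right h, inf_eq_right.2 (IsCyclic.le_of_card_le hG hC hL hK h)]

theorem lowerCentralSeries_succ_le_commutator (n : ℕ) :
    (⊤ : Subgroup G).lowerCentralSeries (n + 1) ≤ commutator G :=
  Subgroup.lowerCentralSeries_antitone ⊤ (by omega : 1 ≤ n + 1)

/-- Inside the cyclic group G' the order of γ ∩ Z(G) is the smaller of |γ| and |Z(G) ∩ G'|, so the
order of each term of the series determines that of the next. -/
theorem nilpotencyClass_eq_of_isCyclic_commutator {p : ℕ} [Fact p.Prime] [Finite G] [Finite H]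
    (hG : IsPGroup p G) (hH : IsPGroup p H) (hcG : IsCyclic (commutator G))
    (hcH : IsCyclic (commutator H)) (hcard : Nat.card G = Nat.card H)
    (hcomm : Nat.card (commutator G) = Nat.card (commutator H))
    (hcen : Nat.card (center G ⊓ commutator G : Subgroup G) =
      Nat.card (center H ⊓ commutator H : Subgroup H)) :
    Group.nilpotencyClass H = Group.nilpotencyClass G := by
  have := hG.isNilpotent
  have := hH.isNilpotent
  refine nilpotencyClass_eq_of_card_lowerCentralSeries_eq fun n => ?_
  obtain _ | n := n
  · simpa using hcard
  induction n with
  | zero => exact hcomm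
  | succ n ih =>
    have h1 := card_inf_center_mul_card_commutator_of_isCyclic hG hcG
      ((⊤ : Subgroup G).lowerCentralSeries (n + 1)) (lowerCentralSeries_succ_le_commutator n)
    have h2 := card_inf_center_mul_card_commutator_of_isCyclic hH hcH
      ((⊤ : Subgroup H).lowerCentralSeries (n + 1)) (lowerCentralSeries_succ_le_commutator n)
    rw [← inf_eq_left.2 (lowerCentralSeries_succ_le_commutator (G := G) n), inf_assoc,
      inf_comm (commutator G), card_inf_eq_min_of_isCyclic hG hcG
      (lowerCentralSeries_succ_le_commutator n) inf_le_right,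
      inf_eq_left.2 (lowerCentralSeries_succ_le_commutator (G := G) n)] at h1
    rw [← inf_eq_left.2 (lowerCentralSeries_succ_le_commutator (G := H) n), inf_assoc,
      inf_comm (commutator H), card_inf_eq_min_of_isCyclic hH hcH
      (lowerCentralSeries_succ_le_commutator n) inf_le_right,
      inf_eq_left.2 (lowerCentralSeries_succ_le_commutator (G := H) n)] at h2
    rw [← ih, ← hcen] at h2
    exact Nat.eq_of_mul_eq_mul_left (lt_min Nat.card_pos Nat.card_pos) (h1.trans h2.symm)

theorem nilpotencyClass_eq_two_iff [Group.IsNilpotent G] :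
    Group.nilpotencyClass G = 2 ↔ commutator G ≠ ⊥ ∧ commutator G ≤ center G := by
  have h1 : commutator G = ⊥ ↔ Group.nilpotencyClass G ≤ 1 :=
    Subgroup.lowerCentralSeries_eq_bot_iff_nilpotencyClass_le (n := 1)
  have h2 : commutator G ≤ center G ↔ Group.nilpotencyClass G ≤ 2 := by
    rw [← Subgroup.lowerCentralSeries_eq_bot_iff_nilpotencyClass_le, Subgroup.lowerCentralSeries_succ,
      top_lowerCentralSeries_one, commutator_eq_bot_iff_le_centralizer, coe_top,
      centralizer_univ]
  rw [Ne, h1, h2]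
  omega

theorem nilpotencyClass_eq_two_of_card_eq [Finite G] [Finite H] [Group.IsNilpotent G]
    [Group.IsNilpotent H] (h : Group.nilpotencyClass G = 2)
    (hcomm : Nat.card (commutator G) = Nat.card (commutator H))
    (hcen : Nat.card (center G ⊓ commutator G : Subgroup G) =
      Nat.card (center H ⊓ commutator H : Subgroup H)) :
    Group.nilpotencyClass H = 2 := by
  rw [nilpotencyClass_eq_two_iff] at h ⊢
  refine ⟨fun h0 => h.1 ?_, ?_⟩
  · rw [← Subgroup.card_eq_one, hcomm, h0, Subgroup.card_bot]
  · rw [inf_eq_right.2 h.2, hcomm] at hcen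
    have := Subgroup.eq_of_le_of_card_ge (inf_le_right : center H ⊓ commutator H ≤ _) hcen.le
    exact inf_eq_right.1 this

end NilpotentGroups

/-! ### p-groups with an abelian subgroup of index p -/

section AbelianSubgroupOfPrimeIndex

open Module
open scoped commutatorElement

variable {G H : Type*} [Group G] [Group H] {p : ℕ} [Fact p.Prime]

open Subgroup

theorem IsPGroup.normal_of_index_eq [Finite G] (hG : IsPGroup p G) {A : Subgroup G}
    (hA : A.index = p) : A.Normal := by
  refine normal_of_index_eq_minFac_card ?_
  obtain ⟨n, hn⟩ := IsPGroup.iff_card.1 hG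
  have hn0 : n ≠ 0 := by
    rintro rfl
    have := A.index_dvd_card
    rw [hA, hn, pow_zero] at this
    exact (Fact.out : p.Prime).one_lt.ne' (Nat.dvd_one.1 this)
  rw [hA, hn, Nat.Prime.pow_minFac Fact.out hn0]

theorem Subgroup.exists_eq_mul_pow_of_index_eq_prime [Finite G] {A : Subgroup G} [A.Normal]
    (hA : A.index = p) {g : G} (hg : g ∉ A) (h : G) : ∃ a ∈ A, ∃ i : ℕ, h = a * g ^ i := by
  have htop : A ⊔ zpowers g = ⊤ := by
    have h1 := relIndex_mul_index (le_sup_left : A ≤ A ⊔ zpowers g)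
    rw [hA] at h1
    rcases (Nat.dvd_prime Fact.out).1 (Dvd.intro_left _ h1) with h2 | h2
    · exact index_eq_one.1 h2
    · rw [h2] at h1
      have h3 : A.relIndex (A ⊔ zpowers g) = 1 :=
        Nat.eq_of_mul_eq_mul_right (Fact.out : p.Prime).pos (by rw [h1, one_mul])
      rw [relIndex_eq_one] at h3
      exact absurd (h3 (mem_sup_right (mem_zpowers g))) hg
  have hh : h ∈ A ⊔ zpowers g := htop ▸ mem_top h
  obtain ⟨a, ha, z, hz, rfl⟩ := mem_sup_of_normal_left.1 hh
  classical
  obtain ⟨i, rfl⟩ := (mem_zpowers_iff_mem_range_orderOf.trans Finset.mem_image).1 hz |>.imp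
    fun _ h => h.2
  exact ⟨a, ha, i, rfl⟩

variable [Finite G] [Finite H]

/-- Every element is a g^i with a in `A` and a fixed g outside `A`. Since `A` is abelian and normal,
⁅n, a g^i⁆ = ⁅n, g^i⁆, and this equals ⁅m, g⁆ with m the product of the conjugates of n by g^0, ...,
g^(i-1). -/
theorem IsPGroup.card_inf_center_mul_card_commutator_of_index_eq (hG : IsPGroup p G)
    {A : Subgroup G} (hAc : ∀ a ∈ A, ∀ b ∈ A, a * b = b * a) (hA : A.index = p) (N : Subgroup G)
    [N.Normal] (hN : N ≤ A) :
    Nat.card (N ⊓ center G : Subgroup G) * Nat.card ↥⁅N, (⊤ : Subgroup G)⁆ = Nat.card N := by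
  have := hG.normal_of_index_eq hA
  obtain ⟨g, hg⟩ : ∃ g, g ∉ A := by
    by_contra! hcon
    rw [(eq_top_iff' A).2 hcon, index_top] at hA
    exact (Fact.out : p.Prime).one_lt.ne hA
  have hdec := exists_eq_mul_pow_of_index_eq_prime hA hg
  refine card_inf_center_mul_card_commutator N (fun a ha b hb => hAc a (hN ha) b (hN hb)) g
    (fun n hn h1 => mem_center_iff.2 fun h => ?_) fun n hn h => ?_
  · obtain ⟨a, ha, i, rfl⟩ := hdec h
    have hc1 : Commute n g := commutatorElement_eq_one_iff_mul_comm.1 h1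
    have hc2 : Commute n a := hAc n (hN hn) a ha
    exact ((hc2.mul_right (hc1.pow_right i))).symm
  · obtain ⟨a, ha, i, rfl⟩ := hdec h
    have key : ∀ i : ℕ, ∃ m ∈ N, ⁅m, g⁆ = ⁅n, g ^ i⁆ := by
      intro i
      induction i with
      | zero => exact ⟨1, one_mem N, by simp⟩
      | succ i ih =>
        obtain ⟨m, hm, e⟩ := ih
        have hc : g ^ i * n * (g ^ i)⁻¹ ∈ N := ‹N.Normal›.conj_mem n hn (g ^ i)
        refine ⟨m * (g ^ i * n * (g ^ i)⁻¹), mul_mem hm hc, ?_⟩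
        have := (commutatorHom N (fun a ha b hb => hAc a (hN ha) b (hN hb)) g).map_mul
          ⟨m, hm⟩ ⟨_, hc⟩
        rw [commutatorHom_apply, commutatorHom_apply, commutatorHom_apply] at this
        refine this.trans ?_
        simp only [e, commutatorElement_def]
        group
    obtain ⟨m, hm, e⟩ := key i
    refine ⟨m, hm, e.trans ?_⟩
    have h1 : n * (g ^ i * n⁻¹ * (g ^ i)⁻¹) ∈ A :=
      mul_mem (hN hn) (‹A.Normal›.conj_mem _ (inv_mem (hN hn)) _)
    have h2 := hAc a ha _ h1
    have h3 := hAc n (hN hn) a ha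
    rw [commutatorElement_def, commutatorElement_def]
    calc n * g ^ i * n⁻¹ * (g ^ i)⁻¹ = (n * (g ^ i * n⁻¹ * (g ^ i)⁻¹)) * a * a⁻¹ := by group
      _ = a * (n * (g ^ i * n⁻¹ * (g ^ i)⁻¹)) * a⁻¹ := by rw [← h2]
      _ = (a * n) * (g ^ i * n⁻¹ * (g ^ i)⁻¹) * a⁻¹ := by group
      _ = (n * a) * (g ^ i * n⁻¹ * (g ^ i)⁻¹) * a⁻¹ := by rw [h3]
      _ = _ := by group

theorem IsPGroup.commutator_le_of_index_eq (hG : IsPGroup p G) {A : Subgroup G}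
    (hA : A.index = p) : commutator G ≤ A := by
  have := hG.normal_of_index_eq hA
  have hc : IsCyclic (G ⧸ A) := isCyclic_of_prime_card (p := p) hA
  have hcomm := (IsCyclic.commGroup (α := G ⧸ A)).mul_comm
  refine commutator_le.2 fun x _ y _ => ?_
  rw [← QuotientGroup.eq_one_iff]
  have := commutatorElement_eq_one_iff_mul_comm.2 (hcomm (x : G ⧸ A) (y : G ⧸ A))
  exact this

/-- Modulo ⁅A, G⁆ the subgroup `A` is central, and together with one further element it generates
the quotient, which is therefore abelian. -/
theorem IsPGroup.commutator_eq_of_index_eq (hG : IsPGroup p G) {A : Subgroup G}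
    (hA : A.index = p) : ⁅A, (⊤ : Subgroup G)⁆ = commutator G := by
  have := hG.normal_of_index_eq hA
  obtain ⟨g, hg⟩ : ∃ g, g ∉ A := by
    by_contra! hcon
    rw [(eq_top_iff' A).2 hcon, index_top] at hA
    exact (Fact.out : p.Prime).one_lt.ne hA
  apply le_antisymm (commutator_mono le_top le_rfl)
  have hcom : ∀ a ∈ A, ∀ x : G, Commute (QuotientGroup.mk' ⁅A, (⊤ : Subgroup G)⁆ a)
      (QuotientGroup.mk' ⁅A, (⊤ : Subgroup G)⁆ x) := fun a ha x => by
    rw [Commute, SemiconjBy, ← commutatorElement_eq_one_iff_mul_comm, ← map_commutatorElement,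
      ← MonoidHom.mem_ker, QuotientGroup.ker_mk']
    exact commutator_mem_commutator ha (mem_top x)
  refine commutator_le.2 fun x _ y _ => ?_
  rw [← QuotientGroup.ker_mk' ⁅A, (⊤ : Subgroup G)⁆, MonoidHom.mem_ker, map_commutatorElement,
    commutatorElement_eq_one_iff_mul_comm]
  obtain ⟨a, ha, i, rfl⟩ := exists_eq_mul_pow_of_index_eq_prime hA hg x
  obtain ⟨b, hb, j, rfl⟩ := exists_eq_mul_pow_of_index_eq_prime hA hg y
  change Commute _ _
  rw [map_mul]
  refine Commute.mul_left (hcom a ha _) ?_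
  rw [map_mul]
  refine Commute.mul_right (hcom b hb _).symm ?_
  rw [map_pow, map_pow]
  exact Commute.pow_pow (Commute.refl _) i j

theorem IsPGroup.inf_center_ne_bot (hG : IsPGroup p G) {N : Subgroup G} [N.Normal]
    (hN : N ≠ ⊥) : N ⊓ center G ≠ ⊥ := by
  have h1 : p ∣ Nat.card N := by
    rcases (hG.to_subgroup N).card_eq_or_dvd with h | h
    · exact absurd (Subgroup.card_eq_one.1 h) hN
    · exact h
  have h0 : (1 : N) ∈ MulAction.fixedPoints (ConjAct G) N := fun g => smul_one g
  obtain ⟨b, hb, hne⟩ := (hG.of_equiv ConjAct.toConjAct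
    ).exists_fixed_point_of_prime_dvd_card_of_fixed_point N h1 h0
  intro hbot
  have hmem : (b : G) ∈ N ⊓ center G := by
    refine ⟨b.2, mem_center_iff.2 fun g => ?_⟩
    have := congrArg Subtype.val (hb (ConjAct.toConjAct g))
    rw [ConjAct.Subgroup.val_conj_smul, ConjAct.toConjAct_smul] at this
    exact mul_inv_eq_iff_eq_mul.1 this
  rw [hbot, Subgroup.mem_bot] at hmem
  exact hne (Subtype.ext hmem.symm)

theorem IsPGroup.le_card_inf_center (hG : IsPGroup p G) {N : Subgroup G} [N.Normal]
    (hN : N ≠ ⊥) : p ≤ Nat.card (N ⊓ center G : Subgroup G) := by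
  rcases (hG.to_subgroup (N ⊓ center G)).card_eq_or_dvd with h | h
  · exact absurd (Subgroup.card_eq_one.1 h) (hG.inf_center_ne_bot hN)
  · exact Nat.le_of_dvd Nat.card_pos h

theorem IsPGroup.card_lowerCentralSeries_eq_of_index_eq (hG : IsPGroup p G) {A : Subgroup G}
    (hA : A.index = p) (hAc : ∀ a ∈ A, ∀ b ∈ A, a * b = b * a) (n : ℕ) :
    Nat.card ((⊤ : Subgroup G).lowerCentralSeries (n + 1) ⊓ center G : Subgroup G) *
      Nat.card ((⊤ : Subgroup G).lowerCentralSeries (n + 2)) =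
      Nat.card ((⊤ : Subgroup G).lowerCentralSeries (n + 1)) :=
  hG.card_inf_center_mul_card_commutator_of_index_eq hAc hA _
    ((lowerCentralSeries_succ_le_commutator n).trans (hG.commutator_le_of_index_eq hA))

theorem IsPGroup.center_le_of_index_eq (hG : IsPGroup p G) {A : Subgroup G}
    (hA : A.index = p) (hAc : ∀ a ∈ A, ∀ b ∈ A, a * b = b * a) (hne : commutator G ≠ ⊥) :
    center G ≤ A := by
  have := hG.normal_of_index_eq hA
  intro z hz
  by_contra hzA
  refine hne ?_
  rw [← hG.commutator_eq_of_index_eq hA, commutator_eq_bot_iff_le_centralizer]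
  intro a ha
  rw [mem_centralizer_iff]
  intro x _
  obtain ⟨b, hb, i, rfl⟩ := exists_eq_mul_pow_of_index_eq_prime hA hzA x
  have h1 : Commute b a := hAc b hb a ha
  have h2 : Commute z a := (mem_center_iff.1 hz a).symm
  exact h1.mul_left (h2.pow_left i)

/-- In a nonabelian `p`-group with an abelian subgroup `A` of index `p`, `|A| = |Z(G)| |G'|`. -/
theorem IsPGroup.card_center_mul_card_commutator_of_index_eq (hG : IsPGroup p G)
    {A : Subgroup G} (hA : A.index = p) (hAc : ∀ a ∈ A, ∀ b ∈ A, a * b = b * a)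
    (hne : commutator G ≠ ⊥) :
    Nat.card (center G) * Nat.card (commutator G) = Nat.card A := by
  have := hG.normal_of_index_eq hA
  rw [← hG.card_inf_center_mul_card_commutator_of_index_eq hAc hA A le_rfl,
    inf_eq_right.2 (hG.center_le_of_index_eq hA hAc hne), hG.commutator_eq_of_index_eq hA]

/-- A nontrivial normal subgroup meets a centre of order p in the whole centre. From the commutator
subgroup on, each nontrivial term of either series thus has p times the order of the next. -/
theorem nilpotencyClass_eq_of_index_eq (hG : IsPGroup p G) (hH : IsPGroup p H)
    {A : Subgroup G} (hA : A.index = p) (hAc : ∀ a ∈ A, ∀ b ∈ A, a * b = b * a)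
    {B : Subgroup H} (hB : B.index = p) (hBc : ∀ a ∈ B, ∀ b ∈ B, a * b = b * a)
    (hcG : Nat.card (center G) = p) (hcH : Nat.card (center H) = p)
    (hcard : Nat.card G = Nat.card H)
    (hcomm : Nat.card (commutator G) = Nat.card (commutator H)) :
    Group.nilpotencyClass H = Group.nilpotencyClass G := by
  have := hG.isNilpotent
  have := hH.isNilpotent
  refine nilpotencyClass_eq_of_card_lowerCentralSeries_eq fun n => ?_
  obtain _ | n := n
  · simpa using hcard
  induction n with
  | zero => exact hcomm
  | succ n ih =>
    have h1 := hG.card_lowerCentralSeries_eq_of_index_eq hA hAc n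
    have h2 := hH.card_lowerCentralSeries_eq_of_index_eq hB hBc n
    by_cases hb : (⊤ : Subgroup G).lowerCentralSeries (n + 1) = ⊥
    · rw [hb, Subgroup.card_bot, eq_comm, Subgroup.card_eq_one] at ih
      rw [← Subgroup.card_eq_one, ← h1, mul_eq_one] at hb
      rw [← Subgroup.card_eq_one, ← h2, mul_eq_one] at ih
      exact hb.2.trans ih.2.symm
    · have hb' : (⊤ : Subgroup H).lowerCentralSeries (n + 1) ≠ ⊥ := fun h => hb (by
        rw [h, Subgroup.card_bot] at ih
        exact Subgroup.card_eq_one.1 ih)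
      have e1 := le_antisymm ((Subgroup.card_le_of_le (inf_le_right : (⊤ : Subgroup G).lowerCentralSeries
        (n + 1) ⊓ center G ≤ _)).trans hcG.le)
        (hG.le_card_inf_center hb)
      have e2 := le_antisymm ((Subgroup.card_le_of_le (inf_le_right : (⊤ : Subgroup H).lowerCentralSeries
        (n + 1) ⊓ center H ≤ _)).trans hcH.le)
        (hH.le_card_inf_center hb')
      rw [e1] at h1
      rw [e2, ← ih, ← h1] at h2
      exact (Nat.eq_of_mul_eq_mul_left (Fact.out : p.Prime).pos h2).symm

/-- The center and commutator subgroup of a nonabelian `p`-group of maximal class with an abelian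
subgroup of index `p`. -/
theorem IsPGroup.card_center_eq_of_nilpotencyClass_eq (hG : IsPGroup p G) {A : Subgroup G}
    (hA : A.index = p) (hAc : ∀ a ∈ A, ∀ b ∈ A, a * b = b * a) (hne : commutator G ≠ ⊥) {n : ℕ}
    (hn : Nat.card G = p ^ (n + 2)) (hcl : Group.nilpotencyClass G = n + 1) :
    Nat.card (center G) = p ∧ Nat.card (commutator G) = p ^ n := by
  have := hG.isNilpotent
  have hp := (Fact.out : p.Prime)
  -- Counted upwards from the last nontrivial term, each step gains a factor |γ ∩ Z(G)| ≥ p. At `j =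
  -- n` this bounds |G'| below, and |Z(G)| |G'| = |A| = p^(n+1) then leaves only |Z(G)| = p.
  have hlow : ∀ j, j + 1 ≤ n + 1 → p ^ j ≤
      Nat.card ((⊤ : Subgroup G).lowerCentralSeries (n + 1 - j)) := by
    intro j
    induction j with
    | zero => intro _; rw [pow_zero]; exact Nat.card_pos
    | succ j ih =>
      intro hj
      have h1 := hG.card_lowerCentralSeries_eq_of_index_eq hA hAc (n - (j + 1))
      rw [show n - (j + 1) + 1 = n + 1 - (j + 1) by omega,
        show n - (j + 1) + 2 = n + 1 - j by omega] at h1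
      rw [← h1, pow_succ, mul_comm]
      refine Nat.mul_le_mul (hG.le_card_inf_center fun h => ?_) (ih (by omega))
      rw [Subgroup.lowerCentralSeries_eq_bot_iff_nilpotencyClass_le] at h
      omega
  have h1 : p ^ n ≤ Nat.card (commutator G) := by
    have := hlow n le_rfl
    rwa [show n + 1 - n = 1 by omega] at this
  have h2 := hG.card_center_mul_card_commutator_of_index_eq hA hAc hne
  have h3 : Nat.card A = p ^ (n + 1) := by
    have := A.card_mul_index
    rw [hA, hn, pow_succ] at this
    exact Nat.eq_of_mul_eq_mul_right hp.pos this
  have h4 : p ≤ Nat.card (center G) := by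
    have := hG.le_card_inf_center (N := ⊤) (fun h => hne (by
      rw [eq_bot_iff, ← h]; exact le_top))
    rwa [top_inf_eq] at this
  rw [h3, pow_succ, mul_comm] at h2
  have hpn : 0 < p ^ n := pow_pos hp.pos n
  have h5 : Nat.card (center G) ≤ p := by
    by_contra! hcon
    have := Nat.mul_lt_mul_of_le_of_lt h1 hcon Nat.card_pos
    omega
  have h6 := le_antisymm h5 h4
  rw [h6] at h2
  exact ⟨h6, Nat.eq_of_mul_eq_mul_right hp.pos h2⟩

/-- The centralizer orders sum to |G| times the number of classes. A centralizer is all of G for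
central elements, contains `A` for elements of `A`, and otherwise has order at least p², since it
contains the centre and the noncentral element itself. -/
theorem IsPGroup.le_card_conjClasses_of_index_eq (hG : IsPGroup p G) {A : Subgroup G}
    (hA : A.index = p) (hAc : ∀ a ∈ A, ∀ b ∈ A, a * b = b * a) (hne : commutator G ≠ ⊥) {n : ℕ}
    (hn : Nat.card G = p ^ (n + 2)) (hcen : Nat.card (center G) = p) :
    p ^ n + p ^ 2 ≤ Nat.card (ConjClasses G) + 1 := by
  classical
  have hfin := Fintype.ofFinite G
  have hp := (Fact.out : p.Prime)
  have hZA := hG.center_le_of_index_eq hA hAc hne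
  have hcardA : Nat.card A = p ^ (n + 1) := by
    have := A.card_mul_index
    rw [hA, hn, pow_succ] at this
    exact Nat.eq_of_mul_eq_mul_right hp.pos this
  have hcomm := card_comm_eq_card_conjClasses_mul_card G
  rw [Nat.card_congr (Equiv.subtypeProdEquivSigmaSubtype (fun a b : G => Commute a b)),
    Nat.card_sigma] at hcomm
  have hn2 : p ^ 2 ≤ p ^ (n + 1) := by
    have h1 := hG.card_center_mul_card_commutator_of_index_eq hA hAc hne
    have h2 : p ∣ Nat.card (commutator G) := by
      rcases (hG.to_subgroup (commutator G)).card_eq_or_dvd with h | h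
      · exact absurd (Subgroup.card_eq_one.1 h) hne
      · exact h
    rw [← hcardA, ← h1, hcen, sq]
    exact Nat.mul_le_mul_left p (Nat.le_of_dvd Nat.card_pos h2)
  have hn1 : p ^ (n + 1) ≤ p ^ (n + 2) := Nat.pow_le_pow_right hp.pos (by omega)
  have hb : ∀ x : G, ((if x ∈ center G then p ^ (n + 2) - p ^ (n + 1) else 0) +
      (if x ∈ A then p ^ (n + 1) - p ^ 2 else 0) + p ^ 2) ≤ Nat.card {y // Commute x y} := by
    intro x
    have e : Nat.card {y // Commute x y} = Nat.card (centralizer {x}) :=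
      Nat.card_congr (Equiv.subtypeEquivRight fun y => by
        rw [mem_centralizer_singleton_iff]; exact eq_comm)
    rw [e]
    by_cases hxA : x ∈ A
    · by_cases hxZ : x ∈ center G
      · have : centralizer {x} = ⊤ := (eq_top_iff' _).2 fun y =>
          mem_centralizer_singleton_iff.2 (mem_center_iff.1 hxZ y)
        rw [this, card_top, hn, if_pos hxA, if_pos hxZ]
        omega
      · have : A ≤ centralizer {x} := fun y hy =>
          mem_centralizer_singleton_iff.2 (hAc y hy x hxA)
        have := Subgroup.card_le_of_le this
        rw [if_pos hxA, if_neg hxZ]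
        omega
    · have hxZ : x ∉ center G := fun h => hxA (hZA h)
      rw [if_neg hxA, if_neg hxZ, zero_add, zero_add]
      have hlt : center G < centralizer {x} := by
        refine lt_of_le_of_ne (center_le_centralizer _) fun h => hxZ ?_
        rw [h]
        exact mem_centralizer_singleton_iff.2 rfl
      have h1 : p < Nat.card (centralizer {x}) := by
        rw [← hcen]
        by_contra! hcon
        exact hlt.ne (Subgroup.eq_of_le_of_card_ge hlt.le hcon)
      obtain ⟨k, hk⟩ := IsPGroup.iff_card.1 (hG.to_subgroup (centralizer {x}))
      rw [hk] at h1 ⊢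
      have hk1 : 1 < k := (Nat.pow_lt_pow_iff_right hp.one_lt).1 (by rwa [pow_one])
      exact Nat.pow_le_pow_right hp.pos hk1
  have hsum := Finset.sum_le_sum fun x (_ : x ∈ Finset.univ) => hb x
  have hcZ : (Finset.univ.filter fun x => x ∈ center G).card = p := by
    rw [← hcen, Nat.card_eq_fintype_card, Fintype.card_subtype]
  have hcA : (Finset.univ.filter fun x => x ∈ A).card = p ^ (n + 1) := by
    rw [← hcardA, Nat.card_eq_fintype_card, Fintype.card_subtype]
  rw [hcomm, Finset.sum_add_distrib, Finset.sum_add_distrib, ← Finset.sum_filter,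
    ← Finset.sum_filter, Finset.sum_const, Finset.sum_const, Finset.sum_const, hcZ, hcA,
    Finset.card_univ, ← Nat.card_eq_fintype_card, hn, smul_eq_mul, smul_eq_mul, smul_eq_mul] at hsum
  have hpos : 0 < p ^ (n + 2) := pow_pos hp.pos _
  refine Nat.le_of_mul_le_mul_right ?_ hpos
  zify [hn1, hn2] at hsum ⊢
  ring_nf at hsum ⊢
  linarith

end AbelianSubgroupOfPrimeIndex

/-! ### A filtered spanning argument of Poincaré-Birkhoff-Witt type -/

section RestrictedPBW

open Module
open scoped commutatorElement

variable {F A ι : Type*} [Field F] [Ring A] [Algebra F A]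

theorem Submodule.pow_le_pow_of_mul_le {I : Submodule F A} (hI : I * I ≤ I) {m n : ℕ} (hm : 1 ≤ m)
    (h : m ≤ n) : I ^ n ≤ I ^ m := by
  induction n, h using Nat.le_induction with
  | base => exact le_rfl
  | succ n hn ih =>
    refine le_trans ?_ ih
    obtain ⟨j, rfl⟩ := Nat.exists_eq_add_of_le' (hm.trans hn)
    rw [pow_succ, pow_succ, mul_assoc]
    exact mul_le_mul_right hI _

/-- The ordered monomial with exponents `e`. -/
noncomputable def orderedMonomial [Fintype ι] (p : ℕ) (b : ι → A) (e : ι → Fin p) : A :=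
  ((∑ i, Multiset.replicate (e i : ℕ) i).toList.map b).prod

variable {p : ℕ} {b : ι → A} {w : ι → ℕ} {I : Submodule F A}

theorem list_prod_mem_pow (hb : ∀ i, b i ∈ I ^ w i) (l : List ι) :
    (l.map b).prod ∈ I ^ (l.map w).sum := by
  induction l with
  | nil => simp [Submodule.one_eq_span, Submodule.mem_span_singleton_self]
  | cons i l ih =>
    rw [List.map_cons, List.map_cons, List.prod_cons, List.sum_cons, pow_add]
    exact Submodule.mul_mem_mul (hb i) ih

/-- Swapping two neighbours replaces them by their commutator, that is, by single letters of the
same total weight up to a higher power of `I`. The error is thus a combination of shorter words of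
equal weight. The prefix `pre` lets the induction on permutations pass under a cons. -/
theorem list_prod_sub_mem_of_perm {T : Submodule F A} (hb : ∀ i, b i ∈ I ^ w i)
    (hcomm : ∀ i j, b i * b j - b j * b i ∈
      Submodule.span F (b '' {k | w k = w i + w j}) ⊔ I ^ (w i + w j + 1)) {n : ℕ}
    (hn : ∀ l : List ι, l.length < n → (l.map b).prod ∈ T ⊔ I ^ ((l.map w).sum + 1))
    {l l' : List ι} (h : l.Perm l') : ∀ pre : List ι, (pre ++ l).length = n →
      ((pre ++ l).map b).prod - ((pre ++ l').map b).prod ∈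
        T ⊔ I ^ (((pre ++ l).map w).sum + 1) := by
  induction h with
  | nil => intro pre _; rw [sub_self]; exact zero_mem _
  | cons x h ih =>
    intro pre hl
    have := ih (pre ++ [x]) (by simpa using hl)
    simpa using this
  | swap x y l =>
    intro pre hl
    have e : ((pre ++ y :: x :: l).map b).prod - ((pre ++ x :: y :: l).map b).prod =
        (pre.map b).prod * (b y * b x - b x * b y) * (l.map b).prod := by
      simp only [List.map_append, List.map_cons, List.prod_append, List.prod_cons]
      noncomm_ring
    have hw : ((pre ++ y :: x :: l).map w).sum =
        (pre.map w).sum + (w y + w x) + (l.map w).sum := by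
      simp only [List.map_append, List.map_cons, List.sum_append, List.sum_cons]
      ring
    rw [e, hw]
    let f : A →ₗ[F] A := LinearMap.mulRight F (l.map b).prod ∘ₗ LinearMap.mulLeft F (pre.map b).prod
    have hle : Submodule.span F (b '' {k | w k = w y + w x}) ⊔ I ^ (w y + w x + 1) ≤
        (T ⊔ I ^ ((pre.map w).sum + (w y + w x) + (l.map w).sum + 1)).comap f := by
      refine sup_le (Submodule.span_le.2 ?_) fun c hc => ?_
      · rintro _ ⟨k, hk, rfl⟩
        have hk' : w k = w y + w x := hk
        have := hn (pre ++ k :: l) (by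
          simp only [List.length_append, List.length_cons] at hl ⊢
          omega)
        simp only [List.map_append, List.map_cons, List.sum_append, List.sum_cons,
          List.prod_append, List.prod_cons, hk', ← add_assoc, ← mul_assoc] at this ⊢
        exact this
      · refine Submodule.mem_sup_right ?_
        have h1 := Submodule.mul_mem_mul (Submodule.mul_mem_mul (list_prod_mem_pow hb pre) hc)
          (list_prod_mem_pow hb l)
        rw [← pow_add, ← pow_add] at h1
        rw [show (pre.map w).sum + (w y + w x) + (l.map w).sum + 1 =
          (pre.map w).sum + (w y + w x + 1) + (l.map w).sum by ring]
        exact h1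
    exact hle (hcomm y x)
  | trans h1 h2 ih1 ih2 =>
    intro pre hl
    rename_i l₁ l₂ l₃
    have hp1 : (pre ++ l₁).Perm (pre ++ l₂) := h1.append_left pre
    have e1 := ih1 pre hl
    have e2 := ih2 pre (hp1.length_eq ▸ hl)
    rw [← (hp1.map w).sum_eq] at e2
    have := add_mem e1 e2
    rwa [sub_add_sub_cancel] at this

/-- By induction on length a word may be rearranged freely. If each letter occurs fewer than p times
it is sorted into an ordered monomial; otherwise p equal letters are brought to the front and the
product vanishes. -/
theorem list_prod_mem_span_orderedMonomial [Fintype ι] (hb : ∀ i, b i ∈ I ^ w i)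
    (hcomm : ∀ i j, b i * b j - b j * b i ∈
      Submodule.span F (b '' {k | w k = w i + w j}) ⊔ I ^ (w i + w j + 1))
    (hp : ∀ i, b i ^ p = 0) (n : ℕ) : ∀ l : List ι, l.length < n → (l.map b).prod ∈
      Submodule.span F (Set.range (orderedMonomial p b)) ⊔ I ^ ((l.map w).sum + 1) := by
  classical
  induction n with
  | zero => intro l hl; omega
  | succ n ih =>
    intro l hl
    rcases Nat.lt_or_ge l.length n with h | h
    · exact ih l h
    have hln : l.length = n := by omega
    have key : ∀ l' : List ι, l.Perm l' → (l'.map b).prod ∈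
        Submodule.span F (Set.range (orderedMonomial p b)) → (l.map b).prod ∈
        Submodule.span F (Set.range (orderedMonomial p b)) ⊔ I ^ ((l.map w).sum + 1) := by
      intro l' hl' h'
      have := add_mem (list_prod_sub_mem_of_perm hb hcomm ih hl' [] hln)
        (Submodule.mem_sup_left h')
      simpa using this
    by_cases hc : ∀ i, l.count i < p
    · refine key (l : Multiset ι).toList ?_ (Submodule.subset_span ⟨fun i => ⟨l.count i, hc i⟩, ?_⟩)
      · rw [← Multiset.coe_eq_coe, Multiset.coe_toList]
      · have : ∑ i, Multiset.replicate (l.count i) i = (l : Multiset ι) := by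
          ext a
          simp [Multiset.count_sum', Multiset.count_replicate]
        simp only [orderedMonomial, this]
    · push Not at hc
      obtain ⟨i, hi⟩ := hc
      obtain ⟨r, hr⟩ := (List.replicate_sublist_iff.2 hi).exists_perm_append
      refine key _ hr ?_
      simp [hp i]

/-- The spanning half of the Poincaré-Birkhoff-Witt theorem for restricted Lie algebras, in a
filtered form. -/
theorem finrank_le_pow_card [Fintype ι] {N : ℕ} (hN : I ^ N = ⊥) (hI : I * I ≤ I)
    (htop : (⊤ : Submodule F A) ≤ 1 ⊔ I) (hb : ∀ i, b i ∈ I ^ w i)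
    (hcomm : ∀ i j, b i * b j - b j * b i ∈
      Submodule.span F (b '' {k | w k = w i + w j}) ⊔ I ^ (w i + w j + 1))
    (hp : ∀ i, b i ^ p = 0) (hp0 : 0 < p)
    (hgen : I ≤ Submodule.span F (b '' {k | w k = 1}) ⊔ I ^ 2) :
    finrank F A ≤ p ^ Fintype.card ι := by
  classical
  set T := Submodule.span F (Set.range (orderedMonomial p b)) with hT
  have hlist : ∀ l : List ι, (l.map b).prod ∈ T ⊔ I ^ ((l.map w).sum + 1) := fun l =>
    list_prod_mem_span_orderedMonomial hb hcomm hp (l.length + 1) l (by omega)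
  -- Weight-one letters span `I` modulo `I ^ 2`, so words of weight `n` span `I ^ n` modulo the next
  -- power. Nilpotency of `I` later removes the remainders.
  have hpow : ∀ n, 1 ≤ n → I ^ n ≤
      Submodule.span F {x | ∃ l : List ι, (l.map w).sum = n ∧ (l.map b).prod = x} ⊔
        I ^ (n + 1) := by
    intro n hn
    induction n, hn using Nat.le_induction with
    | base =>
      rw [pow_one]
      refine hgen.trans (sup_le_sup_right (Submodule.span_mono ?_) _)
      rintro _ ⟨k, hk, rfl⟩
      exact ⟨[k], by simpa using hk, by simp⟩
    | succ n hn ih =>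
      rw [pow_succ]
      refine (mul_le_mul' ih hgen).trans ?_
      have hB : Submodule.span F (b '' {k | w k = 1}) ≤ I := by
        rw [Submodule.span_le]
        rintro _ ⟨k, hk, rfl⟩
        have := hb k
        rwa [show w k = 1 from hk, pow_one] at this
      have hL : Submodule.span F {x | ∃ l : List ι, (l.map w).sum = n ∧ (l.map b).prod = x} ≤
          I ^ n := by
        rw [Submodule.span_le]
        rintro _ ⟨l, hl, rfl⟩
        exact hl ▸ list_prod_mem_pow hb l
      rw [Submodule.sup_mul, Submodule.mul_sup]
      refine sup_le (sup_le ?_ ?_) ?_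
      · refine le_trans ?_ le_sup_left
        rw [Submodule.span_mul_span]
        refine Submodule.span_mono ?_
        rintro _ ⟨_, ⟨l, hl, rfl⟩, _, ⟨k, hk, rfl⟩, rfl⟩
        have hk' : w k = 1 := hk
        exact ⟨l ++ [k], by simp [hl, hk'], by simp⟩
      · refine le_trans ?_ le_sup_right
        rw [show n + 1 + 1 = n + 2 from rfl, pow_add]
        exact mul_le_mul_left hL _
      · refine le_trans ?_ le_sup_right
        rw [pow_succ I (n + 1)]
        refine mul_le_mul_right (sup_le hB ?_) _
        rw [sq]
        exact hI
  have hstep : ∀ n, 1 ≤ n → I ^ n ≤ T ⊔ I ^ (n + 1) := by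
    intro n hn
    refine (hpow n hn).trans (sup_le (Submodule.span_le.2 ?_) le_sup_right)
    rintro _ ⟨l, hl, rfl⟩
    exact hl ▸ hlist l
  have hall : ∀ n, 1 ≤ n → I ≤ T ⊔ I ^ n := by
    intro n hn
    induction n, hn using Nat.le_induction with
    | base => simp
    | succ n hn ih => exact ih.trans (sup_le le_sup_left (hstep n hn))
  have hIT : I ≤ T := by
    have := hall (N + 1) (by omega)
    rwa [pow_succ, hN, Submodule.bot_mul, sup_bot_eq] at this
  have hone : (1 : A) ∈ T := by
    refine Submodule.subset_span ⟨fun _ => ⟨0, hp0⟩, ?_⟩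
    simp [orderedMonomial]
  have hTtop : T = ⊤ := by
    refine top_le_iff.1 (htop.trans (sup_le ?_ hIT))
    rw [Submodule.one_eq_span, Submodule.span_singleton_le_iff_mem]
    exact hone
  rw [← finrank_top, ← hTtop]
  refine (finrank_range_le_card (R := F) (orderedMonomial p b)).trans ?_
  simp

end RestrictedPBW

/-! ### Commutators of terms of the lower central series -/

section LowerCentralSeries

open Module
open scoped commutatorElement

open Subgroup

theorem Subgroup.commutator_commutator_le_of_rotate {G : Type*} [Group G]
    {H₁ H₂ H₃ N : Subgroup G} [N.Normal] (h1 : ⁅⁅H₂, H₃⁆, H₁⁆ ≤ N) (h2 : ⁅⁅H₃, H₁⁆, H₂⁆ ≤ N) :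
    ⁅⁅H₁, H₂⁆, H₃⁆ ≤ N := by
  have hq : ∀ K : Subgroup G, K ≤ N ↔ K.map (QuotientGroup.mk' N) = ⊥ := fun K => by
    rw [Subgroup.map_eq_bot_iff, QuotientGroup.ker_mk']
  rw [hq, map_commutator, map_commutator] at *
  exact commutator_commutator_eq_bot_of_rotate h1 h2

/-- This is the three subgroups lemma with induction on `j`. Terms are numbered from 0, so the term
with index `i` has weight i + 1, and weights add. -/
theorem commutator_lowerCentralSeries_le {G : Type*} [Group G] (i j : ℕ) :
    ⁅(⊤ : Subgroup G).lowerCentralSeries i, (⊤ : Subgroup G).lowerCentralSeries j⁆ ≤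
      (⊤ : Subgroup G).lowerCentralSeries (i + j + 1) := by
  induction j generalizing i with
  | zero => exact le_rfl
  | succ j ih =>
    rw [show i + (j + 1) + 1 = i + j + 2 by ring, commutator_comm,
      Subgroup.lowerCentralSeries_succ]
    refine commutator_commutator_le_of_rotate ?_ (commutator_mono (ih i) le_rfl)
    have := ih (i + 1)
    rwa [show i + 1 + j + 1 = i + j + 2 by ring, Subgroup.lowerCentralSeries_succ,
      commutator_comm _ ⊤] at this

end LowerCentralSeries

/-! ### Lie powers of the augmentation ideal and groups of exponent p -/

section LieFiltration

open Module
open scoped commutatorElement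

variable {F A G H : Type*} [Field F] [Ring A] [Algebra F A] [Group G] [Group H]

/-- The Lie powers of `I`, each taken modulo the next associative power. -/
def lieFiltration (I : Submodule F A) : ℕ → Submodule F A
  | 0 => I
  | n + 1 => Submodule.span F {x | ∃ a ∈ lieFiltration I n, ∃ b ∈ I, a * b - b * a = x} ⊔
      I ^ (n + 3)

/-- The dimension of the image of the `n`-th Lie power in the associated graded algebra. -/
noncomputable def lieRank (I : Submodule F A) (n : ℕ) : ℕ :=
  finrank F ((lieFiltration I n).map (I ^ (n + 2)).mkQ)

variable {u : Basis G F A}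

theorem mul_mem_augSpan_top_pow (hu : IsGroupBasis u) {n : ℕ} (hn : n ≠ 0) {a : A} (b : A)
    (ha : a ∈ augSpan u ⊤ ^ n) : a * b ∈ augSpan u ⊤ ^ n := by
  obtain ⟨n, rfl⟩ := Nat.exists_eq_succ_of_ne_zero hn
  have h : augSpan u ⊤ ^ (n + 1) * ⊤ ≤ augSpan u ⊤ ^ (n + 1) := by
    rw [pow_succ, mul_assoc]
    exact mul_le_mul_right (Submodule.mul_le.2 fun x hx y _ => mul_mem_augSpan_top' hu y hx) _
  exact h (Submodule.mul_mem_mul ha trivial)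

theorem mul_mem_augSpan_top_pow' (hu : IsGroupBasis u) {n : ℕ} (hn : n ≠ 0) (a : A) {b : A}
    (hb : b ∈ augSpan u ⊤ ^ n) : a * b ∈ augSpan u ⊤ ^ n := by
  obtain ⟨n, rfl⟩ := Nat.exists_eq_succ_of_ne_zero hn
  have h : ⊤ * augSpan u ⊤ ^ (n + 1) ≤ augSpan u ⊤ ^ (n + 1) := by
    rw [pow_succ', ← mul_assoc]
    exact mul_le_mul_left (Submodule.mul_le.2 fun x _ y hy => mul_mem_augSpan_top hu x hy) _
  exact h (Submodule.mul_mem_mul trivial hb)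

theorem augSpan_top_pow_le (hu : IsGroupBasis u) {m n : ℕ} (hm : 1 ≤ m) (h : m ≤ n) :
    augSpan u ⊤ ^ n ≤ augSpan u ⊤ ^ m :=
  Submodule.pow_le_pow_of_mul_le (augSpan_top_mul_self_le hu) hm h

theorem IsGroupBasis.lie_sub_one (hu : IsGroupBasis u) (x y : G) :
    (u x - 1) * (u y - 1) - (u y - 1) * (u x - 1) = (u ⁅x, y⁆ - 1) * u (y * x) := by
  have : u ⁅x, y⁆ * u (y * x) = u x * u y := by
    rw [← hu.mul, ← hu.mul, commutatorElement_def]; congr 1; group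
  rw [sub_mul (u ⁅x, y⁆), this, hu.mul]
  noncomm_ring

theorem IsGroupBasis.lie_sub_one' (hu : IsGroupBasis u) (x y : G) :
    (u x - 1) * (u y - 1) - (u y - 1) * (u x - 1) =
      (u ⁅x, y⁆ - 1) + (u ⁅x, y⁆ - 1) * (u (y * x) - 1) := by
  rw [hu.lie_sub_one]; noncomm_ring

theorem sub_one_mem_augSpan_top_pow (hu : IsGroupBasis u) (n : ℕ) {g : G}
    (hg : g ∈ (⊤ : Subgroup G).lowerCentralSeries n) : u g - 1 ∈ augSpan u ⊤ ^ (n + 1) := by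
  induction n generalizing g with
  | zero => simpa using sub_one_mem_augSpan u (Subgroup.mem_top g)
  | succ n ih =>
    rw [Subgroup.mem_lowerCentralSeries_succ_iff] at hg
    have hl := fun a {b : A} hb =>
      mul_mem_augSpan_top_pow' hu (show n + 1 + 1 ≠ 0 by omega) a (b := b) hb
    induction hg using Subgroup.closure_induction with
    | mem x hx =>
      obtain ⟨a, ha, b, -, rfl⟩ := hx
      have h1 : u ⁅a, b⁆ - 1 = ((u a - 1) * (u b - 1) - (u b - 1) * (u a - 1)) *
          u (b * a)⁻¹ := by
        rw [hu.lie_sub_one, mul_assoc, hu.mul_inv, mul_one]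
      rw [h1]
      refine mul_mem_augSpan_top_pow hu (by omega) _ (sub_mem ?_ ?_)
      · rw [pow_succ]
        exact Submodule.mul_mem_mul (ih ha) (sub_one_mem_augSpan u (Subgroup.mem_top b))
      · rw [pow_succ']
        exact Submodule.mul_mem_mul (sub_one_mem_augSpan u (Subgroup.mem_top b)) (ih ha)
    | one => simp [hu.one]
    | mul x y _ _ hx hy =>
      have : u (x * y) - 1 = u x * (u y - 1) + (u x - 1) := by rw [hu.mul]; noncomm_ring
      rw [this]
      exact add_mem (hl _ hy) hx
    | inv x _ hx =>
      have : u x⁻¹ - 1 = (-u x⁻¹) * (u x - 1) := by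
        rw [neg_mul, mul_sub, hu.inv_mul]; simp
      rw [this]
      exact hl _ hx

/-- By `IsGroupBasis.lie_sub_one'` the additive commutator of `u x - 1` and `u y - 1` is `u ⁅x, y⁆ -
1` up to a product lying in a higher power. Group commutators and Lie commutators therefore span the
same space in each degree. -/
theorem lieFiltration_augSpan (hu : IsGroupBasis u) (n : ℕ) :
    lieFiltration (augSpan u ⊤) n =
      augSpan u ((⊤ : Subgroup G).lowerCentralSeries n) ⊔ augSpan u ⊤ ^ (n + 2) := by
  set I := augSpan u ⊤ with hI
  induction n with
  | zero =>
    have : I ^ 2 ≤ I := by simpa using augSpan_top_pow_le hu (le_refl 1) (show 1 ≤ 2 by omega)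
    change I = I ⊔ I ^ 2
    exact (sup_eq_left.2 this).symm
  | succ n ih =>
    have hlie : ∀ a ∈ lieFiltration I n, ∀ b ∈ I, a * b - b * a ∈ lieFiltration I (n + 1) :=
      fun a ha b hb => Submodule.mem_sup_left (Submodule.subset_span ⟨a, ha, b, hb, rfl⟩)
    apply le_antisymm
    · refine sup_le (Submodule.span_le.2 ?_) le_sup_right
      rintro _ ⟨a, ha, b, hb, rfl⟩
      rw [ih] at ha
      set W := augSpan u ((⊤ : Subgroup G).lowerCentralSeries (n + 1)) ⊔ I ^ (n + 1 + 2)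
      have h1 : ∀ y ∈ (⊤ : Subgroup G).lowerCentralSeries n, ∀ b ∈ I,
          (u y - 1) * b - b * (u y - 1) ∈ W := by
        intro y hy b hb
        have : I ≤ W.comap (LinearMap.mulLeft F (u y - 1) - LinearMap.mulRight F (u y - 1)) := by
          refine augSpan_le.2 fun g _ => ?_
          have hw := Subgroup.commutator_mem_commutator hy (Subgroup.mem_top g)
          change (u y - 1) * (u g - 1) - (u g - 1) * (u y - 1) ∈ W
          rw [hu.lie_sub_one']
          refine add_mem (Submodule.mem_sup_left (sub_one_mem_augSpan u hw))
            (Submodule.mem_sup_right ?_)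
          rw [show n + 1 + 2 = (n + 1 + 1) + 1 from rfl, pow_succ]
          exact Submodule.mul_mem_mul (sub_one_mem_augSpan_top_pow hu (n + 1) hw)
            (sub_one_mem_augSpan u (Subgroup.mem_top _))
        exact this hb
      have h2 : augSpan u ((⊤ : Subgroup G).lowerCentralSeries n) ⊔ I ^ (n + 2) ≤
          W.comap (LinearMap.mulRight F b - LinearMap.mulLeft F b) := by
        refine sup_le (augSpan_le.2 fun y hy => h1 y hy b hb) fun c hc => ?_
        change c * b - b * c ∈ W
        refine Submodule.mem_sup_right (sub_mem ?_ ?_)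
        · rw [show n + 1 + 2 = (n + 2) + 1 from rfl, pow_succ]
          exact Submodule.mul_mem_mul hc hb
        · rw [show n + 1 + 2 = (n + 2) + 1 from rfl, pow_succ']
          exact Submodule.mul_mem_mul hb hc
      exact h2 ha
    · refine sup_le (augSpan_le.2 fun w hw => ?_) le_sup_right
      have hprod : ∀ w ∈ (⊤ : Subgroup G).lowerCentralSeries (n + 1), ∀ g : G,
          (u w - 1) * (u g - 1) ∈ lieFiltration I (n + 1) := by
        intro w hw g
        refine Submodule.mem_sup_right ?_
        rw [show n + 3 = (n + 1 + 1) + 1 from rfl, pow_succ]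
        exact Submodule.mul_mem_mul (sub_one_mem_augSpan_top_pow hu (n + 1) hw)
          (sub_one_mem_augSpan u (Subgroup.mem_top g))
      rw [Subgroup.mem_lowerCentralSeries_succ_iff] at hw
      induction hw using Subgroup.closure_induction with
      | mem x hx =>
        obtain ⟨a, ha, b, -, rfl⟩ := hx
        have h1 := hu.lie_sub_one' a b
        rw [← sub_eq_iff_eq_add] at h1
        rw [← h1]
        refine sub_mem (hlie _ ?_ _ (sub_one_mem_augSpan u (Subgroup.mem_top b)))
          (hprod _ (Subgroup.commutator_mem_commutator ha (Subgroup.mem_top b)) _)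
        rw [ih]
        exact Submodule.mem_sup_left (sub_one_mem_augSpan u ha)
      | one => simp [hu.one]
      | mul x y hx' hy' hx hy =>
        have : u (x * y) - 1 = (u x - 1) + (u y - 1) + (u x - 1) * (u y - 1) := by
          rw [hu.mul]; noncomm_ring
        rw [this]
        exact add_mem (add_mem hx hy) (hprod x hx' y)
      | inv x hx' hx =>
        have : u x⁻¹ - 1 = -(u x - 1) - (u x - 1) * (u x⁻¹ - 1) := by
          rw [mul_sub, sub_mul, hu.mul_inv]; noncomm_ring
        rw [this]
        exact sub_mem (neg_mem hx) (hprod x hx' _)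

theorem map_lieFiltration_augSpan (hu : IsGroupBasis u) (n : ℕ) :
    (lieFiltration (augSpan u ⊤) n).map (augSpan u ⊤ ^ (n + 2)).mkQ =
      Submodule.span F ((fun g => (augSpan u ⊤ ^ (n + 2)).mkQ (u g - 1)) ''
        ((⊤ : Subgroup G).lowerCentralSeries n : Set G)) := by
  rw [lieFiltration_augSpan hu, Submodule.map_sup]
  conv_lhs => enter [1]; rw [augSpan.eq_def u ((⊤ : Subgroup G).lowerCentralSeries n)]
  rw [Submodule.map_span, Set.image_image]
  simp

/-- A basis of `S` over the prime field spans the `F`-span of `S`; extending scalars cannot raise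
the dimension. -/
theorem pow_finrank_span_le_card {V : Type*} [AddCommGroup V] [Module F V] {p : ℕ} [Fact p.Prime]
    [CharP F p] (S : AddSubgroup V) [Finite S] :
    p ^ finrank F (Submodule.span F (S : Set V)) ≤ Nat.card S := by
  have hp : ∀ x : V, p • x = 0 := fun x => by
    rw [← Nat.cast_smul_eq_nsmul F, CharP.cast_eq_zero, zero_smul]
  have := AddCommGroup.zmodModule hp
  let W : Submodule (ZMod p) V := AddSubgroup.toZModSubmodule p S
  have hWS : (W : Set V) = S := rfl
  have : Finite W := ‹Finite S›
  have : Module.Finite (ZMod p) W := Module.Finite.of_finite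
  have hcard : Nat.card W = p ^ finrank (ZMod p) W := by
    have := Fintype.ofFinite W
    rw [Nat.card_eq_fintype_card, Module.card_eq_pow_finrank (K := ZMod p), ZMod.card]
  have hcard' : Nat.card S = Nat.card W := rfl
  rw [hcard', hcard]
  refine Nat.pow_le_pow_right (Fact.out : p.Prime).pos ?_
  let b := finBasis (ZMod p) W
  have hle : Submodule.span F (S : Set V) ≤ Submodule.span F (Set.range fun i => (b i : V)) := by
    rw [Submodule.span_le]
    intro s hs
    have h1 : s = ∑ i, b.repr ⟨s, hs⟩ i • (b i : V) := by
      have := congrArg W.subtype (b.sum_repr ⟨s, hs⟩)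
      rw [map_sum] at this
      exact this.symm
    rw [h1]
    refine sum_mem fun i _ => ?_
    obtain ⟨m, hm⟩ := ZMod.natCast_zmod_surjective (b.repr ⟨s, hs⟩ i)
    rw [← hm, Nat.cast_smul_eq_nsmul]
    exact nsmul_mem (Submodule.subset_span (Set.mem_range_self i)) m
  have hfd : Module.Finite F (Submodule.span F (Set.range fun i => (b i : V))) :=
    Module.Finite.span_of_finite _ (Set.finite_range _)
  refine (Submodule.finrank_mono hle).trans ?_
  refine (finrank_range_le_card (R := F) fun i => (b i : V)).trans ?_
  simp

/-- Modulo `I ^ (n + 2)` the map g ↦ `u g - 1` is additive on the n-th term, kills the next term,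
and has an image whose `F`-span has dimension `lieRank`. -/
theorem pow_lieRank_mul_card_le {p : ℕ} [Fact p.Prime] [CharP F p] [Finite G]
    (hu : IsGroupBasis u) (n : ℕ) :
    p ^ lieRank (augSpan u ⊤) n * Nat.card ((⊤ : Subgroup G).lowerCentralSeries (n + 1)) ≤
      Nat.card ((⊤ : Subgroup G).lowerCentralSeries n) := by
  set I := augSpan u ⊤ with hI
  set γ := (⊤ : Subgroup G).lowerCentralSeries n with hγ
  let f : γ →* Multiplicative (A ⧸ I ^ (n + 2)) :=
    MonoidHom.mk' (fun g => Multiplicative.ofAdd ((I ^ (n + 2)).mkQ (u g - 1))) (by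
      intro x y
      rw [← ofAdd_add, ← map_add]
      congr 1
      rw [← sub_eq_zero, ← map_sub, ← LinearMap.mem_ker, Submodule.ker_mkQ]
      have : u ((x * y : γ) : G) - 1 - (u x - 1 + (u y - 1)) = (u x - 1) * (u y - 1) := by
        rw [Subgroup.coe_mul, hu.mul]; noncomm_ring
      rw [this]
      have h := Submodule.mul_mem_mul (sub_one_mem_augSpan_top_pow hu n x.2)
        (sub_one_mem_augSpan_top_pow hu n y.2)
      rw [← pow_add] at h
      exact augSpan_top_pow_le hu (by omega) (by omega) h)
  have hker : Nat.card ((⊤ : Subgroup G).lowerCentralSeries (n + 1)) ≤ Nat.card f.ker := by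
    have hle : (⊤ : Subgroup G).lowerCentralSeries (n + 1) ≤ f.ker.map γ.subtype := by
      intro g hg
      refine ⟨⟨g, Subgroup.lowerCentralSeries_antitone ⊤ (Nat.le_succ n) hg⟩, ?_, rfl⟩
      have h := sub_one_mem_augSpan_top_pow hu (n + 1) hg
      rw [SetLike.mem_coe, MonoidHom.mem_ker]
      change Multiplicative.ofAdd _ = Multiplicative.ofAdd 0
      congr 1
      rwa [← LinearMap.mem_ker, Submodule.ker_mkQ]
    refine (Subgroup.card_le_of_le hle).trans ?_
    exact (Nat.card_congr (Subgroup.equivMapOfInjective _ _ γ.subtype_injective).toEquiv).ge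
  have hrange : p ^ lieRank I n ≤ Nat.card f.range := by
    let S : AddSubgroup (A ⧸ I ^ (n + 2)) := Subgroup.toAddSubgroup' f.range
    have hS : (S : Set (A ⧸ I ^ (n + 2))) =
        (fun g => (I ^ (n + 2)).mkQ (u g - 1)) '' (γ : Set G) := by
      ext x
      constructor
      · rintro ⟨g, hg⟩
        exact ⟨g, g.2, hg⟩
      · rintro ⟨g, hg, rfl⟩
        exact ⟨⟨g, hg⟩, rfl⟩
    have : Finite S := (Finite.of_surjective f.rangeRestrict f.rangeRestrict_surjective :
      Finite f.range)
    have h := pow_finrank_span_le_card (F := F) (p := p) S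
    rw [hS, ← map_lieFiltration_augSpan hu] at h
    exact h
  rw [← card_ker_mul_card_range f, mul_comm]
  exact Nat.mul_le_mul hker hrange

/-- For each n, elements of the n-th term are chosen so that the `u g - 1` form a basis of its Lie
layer. With weight n + 1 they satisfy the hypotheses of `finrank_le_pow_card`; exponent p enters as
(u g - 1)^p = u (g^p) - 1 = 0. -/
theorem card_le_pow_sum_lieRank {p : ℕ} [Fact p.Prime] [CharP F p] [Finite G]
    (hu : IsGroupBasis u) (hexp : ∀ g : G, g ^ p = 1) {N : ℕ} (hN : augSpan u ⊤ ^ N = ⊥) :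
    Nat.card G ≤ p ^ ∑ n ∈ Finset.range N, lieRank (augSpan u ⊤) n := by
  classical
  set I := augSpan u ⊤ with hI
  have hp := (Fact.out : p.Prime)
  have hfd : Module.Finite F A := Module.Finite.of_basis u
  have hchar : CharP A p := by
    have := hu.nontrivial
    exact charP_of_injective_algebraMap (algebraMap F A).injective p
  have hex : ∀ n : ℕ, ∃ (Y : Fin (lieRank I n) → G),
      (∀ i, Y i ∈ (⊤ : Subgroup G).lowerCentralSeries n) ∧
      augSpan u ((⊤ : Subgroup G).lowerCentralSeries n) ≤
        Submodule.span F (Set.range fun i => u (Y i) - 1) ⊔ I ^ (n + 2) := by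
    intro n
    obtain ⟨b, hbs, hspan, hli⟩ := exists_linearIndependent F
      ((fun g => (I ^ (n + 2)).mkQ (u g - 1)) ''
        ((⊤ : Subgroup G).lowerCentralSeries n : Set G))
    have hbfin : b.Finite := (Set.toFinite _).subset hbs
    have := hbfin.fintype
    have hcard : Fintype.card b = lieRank I n := by
      rw [lieRank, map_lieFiltration_augSpan hu, ← hspan, finrank_span_set_eq_card hli,
        Set.toFinset_card]
    choose y hy hy' using fun x : b => hbs x.2
    let e := Fintype.equivFinOfCardEq hcard
    refine ⟨fun i => y (e.symm i), fun i => hy _, ?_⟩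
    have h1 : (augSpan u ((⊤ : Subgroup G).lowerCentralSeries n)).map (I ^ (n + 2)).mkQ ≤
        (Submodule.span F (Set.range fun i => u (y (e.symm i)) - 1)).map (I ^ (n + 2)).mkQ := by
      rw [augSpan, Submodule.map_span, Set.image_image, ← hspan, Submodule.map_span,
        Submodule.span_le]
      intro x hx
      refine Submodule.subset_span ⟨_, ⟨e ⟨x, hx⟩, rfl⟩, ?_⟩
      simpa only [Equiv.symm_apply_apply] using hy' ⟨x, hx⟩
    have h2 := Submodule.map_le_iff_le_comap.1 h1
    rwa [Submodule.comap_map_mkQ, sup_comm] at h2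
  choose Y hY hYspan using hex
  let ι := Σ n : Fin N, Fin (lieRank I n)
  let b : ι → A := fun i => u (Y i.1 i.2) - 1
  let w : ι → ℕ := fun i => i.1 + 1
  have hbs : ∀ n, augSpan u ((⊤ : Subgroup G).lowerCentralSeries n) ≤
      Submodule.span F (b '' {k | w k = n + 1}) ⊔ I ^ (n + 2) := by
    intro n
    rcases Nat.lt_or_ge n N with h | h
    · refine (hYspan n).trans (sup_le_sup_right (Submodule.span_mono ?_) _)
      rintro _ ⟨i, rfl⟩
      exact ⟨⟨⟨n, h⟩, i⟩, rfl, rfl⟩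
    -- No letters are needed in these weights, because `I ^ (n + 1)` is already zero.
    · refine augSpan_le.2 fun g hg => ?_
      have h1 := sub_one_mem_augSpan_top_pow hu n hg
      have h2 : I ^ (n + 1) = ⊥ := by
        obtain ⟨j, hj⟩ := Nat.exists_eq_add_of_le ((h.trans (Nat.le_succ n) : N ≤ n + 1))
        rw [hj, pow_add, hN, Submodule.bot_mul]
      rw [h2, Submodule.mem_bot] at h1
      rw [h1]
      exact zero_mem _
  have hmain : finrank F A ≤ p ^ Fintype.card ι := by
    refine finrank_le_pow_card (b := b) (w := w) hN (augSpan_top_mul_self_le hu) ?_ ?_ ?_ ?_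
      hp.pos ?_
    · intro a _
      rw [← sub_add_cancel a (algebraMap F A (augmentation u a)), add_comm]
      exact add_mem (Submodule.mem_sup_left (Submodule.algebraMap_mem _))
        (Submodule.mem_sup_right (sub_augmentation_mem a))
    · exact fun i => sub_one_mem_augSpan_top_pow hu _ (hY _ _)
    · intro i j
      change (u (Y i.1 i.2) - 1) * (u (Y j.1 j.2) - 1) -
        (u (Y j.1 j.2) - 1) * (u (Y i.1 i.2) - 1) ∈ _
      have hc := commutator_lowerCentralSeries_le (i.1 : ℕ) j.1
        (Subgroup.commutator_mem_commutator (hY i.1 i.2) (hY j.1 j.2))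
      have e : (i.1 : ℕ) + 1 + (j.1 + 1) = i.1 + j.1 + 1 + 1 := by ring
      change _ ∈ Submodule.span F (b '' {k | w k = (i.1 : ℕ) + 1 + (j.1 + 1)}) ⊔
        I ^ ((i.1 : ℕ) + 1 + (j.1 + 1) + 1)
      rw [hu.lie_sub_one', e]
      refine add_mem (hbs _ (sub_one_mem_augSpan u hc)) (Submodule.mem_sup_right ?_)
      rw [pow_succ]
      exact Submodule.mul_mem_mul (sub_one_mem_augSpan_top_pow hu _ hc)
        (sub_one_mem_augSpan u (Subgroup.mem_top _))
    · intro i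
      change (u _ - 1) ^ p = 0
      rw [sub_pow_char_of_commute p (Commute.one_right _), one_pow, ← hu.pow, hexp, hu.one,
        sub_self]
    · have := hbs 0
      simpa using this
  rw [← finrank_eq_nat_card_basis u]
  refine hmain.trans (le_of_eq ?_)
  congr 1
  rw [Fintype.card_sigma, ← Fin.sum_univ_eq_sum_range]
  simp

/-- The left side does not increase with `k` and equals |G| at `k = 0`. By `hN` it is still at least
|G| at `k = N`, so it is constant in between. -/
theorem card_lowerCentralSeries_mul_pow_sum_lieRank {p : ℕ} [Fact p.Prime] [CharP F p] [Finite G]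
    (hu : IsGroupBasis u) {N : ℕ} (hN : Nat.card G ≤ p ^ ∑ n ∈ Finset.range N,
      lieRank (augSpan u ⊤) n) {k : ℕ} (hk : k ≤ N) :
    p ^ (∑ n ∈ Finset.range k, lieRank (augSpan u ⊤) n) *
      Nat.card ((⊤ : Subgroup G).lowerCentralSeries k) = Nat.card G := by
  set s : ℕ → ℕ := fun k => p ^ (∑ n ∈ Finset.range k, lieRank (augSpan u ⊤) n) *
      Nat.card ((⊤ : Subgroup G).lowerCentralSeries k) with hs
  have hanti : Antitone s := antitone_nat_of_succ_le fun k => by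
    simp only [hs]
    rw [Finset.sum_range_succ, pow_add, mul_assoc]
    exact Nat.mul_le_mul_left _ (pow_lieRank_mul_card_le hu k)
  have h0 : s 0 = Nat.card G := by simp [hs]
  have h1 : Nat.card G ≤ s N := hN.trans (Nat.le_mul_of_pos_right _ Nat.card_pos)
  exact le_antisymm ((hanti (Nat.zero_le k)).trans h0.le) (h1.trans (hanti hk))

theorem lowerCentralSeries_eq_bot_of_augSpan_top_pow_eq_bot (hu : IsGroupBasis u) {N k : ℕ}
    (hN : augSpan u ⊤ ^ N = ⊥) (hk : N ≤ k) : (⊤ : Subgroup G).lowerCentralSeries k = ⊥ := by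
  rw [eq_bot_iff]
  intro g hg
  have h1 := sub_one_mem_augSpan_top_pow hu k hg
  obtain ⟨j, hj⟩ := Nat.exists_eq_add_of_le (hk.trans (Nat.le_succ k) : N ≤ k + 1)
  rw [hj, pow_add, hN, Submodule.bot_mul, Submodule.mem_bot, sub_eq_zero, ← hu.one] at h1
  exact Subgroup.mem_bot.2 (u.injective h1)

/-- The upper bound on the group order involves only that order and the augmentation ideal. It
therefore holds for `H` without knowing the exponent of `H`. -/
theorem nilpotencyClass_eq_of_exponent_eq {p : ℕ} [Fact p.Prime] [CharP F p] [Finite G] [Finite H]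
    (hG : IsPGroup p G) (hH : IsPGroup p H) {v : Basis H F A} (hu : IsGroupBasis u)
    (hv : IsGroupBasis v) (hexp : Monoid.exponent G = p) :
    Group.nilpotencyClass H = Group.nilpotencyClass G := by
  have := hG.isNilpotent
  have := hH.isNilpotent
  have hp := (Fact.out : p.Prime)
  have hI : augSpan v ⊤ = augSpan u ⊤ := augSpan_top_eq_augSpan_top hH hG hv hu
  obtain ⟨N, hN⟩ := hG.augSpan_top_pow_eq_bot hu
  have hcard := card_le_pow_sum_lieRank hu (fun g => hexp ▸ Monoid.pow_exponent_eq_one g) hN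
  have hcard' := hcard
  rw [card_group_eq (u := u) v, ← hI] at hcard'
  refine nilpotencyClass_eq_of_card_lowerCentralSeries_eq fun k => ?_
  rcases le_total k N with h | h
  · have h1 := card_lowerCentralSeries_mul_pow_sum_lieRank hu hcard h
    have h2 := card_lowerCentralSeries_mul_pow_sum_lieRank hv hcard' h
    rw [hI, ← card_group_eq (u := u) v, ← h1] at h2
    exact (Nat.eq_of_mul_eq_mul_left (pow_pos hp.pos _) h2).symm
  · rw [lowerCentralSeries_eq_bot_of_augSpan_top_pow_eq_bot hu hN h,
      lowerCentralSeries_eq_bot_of_augSpan_top_pow_eq_bot hv (hI ▸ hN) h, Subgroup.card_bot, Subgroup.card_bot]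

end LieFiltration

/-! ### Complex representations and abelian subgroups of index p -/

section ComplexRepresentations

open Module
open scoped commutatorElement

variable {G : Type*} [Group G]

theorem Module.Basis.eq_smul_of_mem_eigenspace {K V ι : Type*} [Field K] [AddCommGroup V]
    [Module K V] [Fintype ι] {f : End K V} (b : Basis ι K V) {μ : ι → K}
    (hμ : Function.Injective μ) (hb : ∀ i, f (b i) = μ i • b i) {w : V} {j : ι}
    (hw : f w = μ j • w) : w = b.repr w j • b j := by
  classical
  have hc : ∀ i, b.coord i ∘ₗ f = μ i • b.coord i := fun i => b.ext fun k => by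
    by_cases h : k = i
    · subst h; simp [hb]
    · simp [hb, Finsupp.single_eq_of_ne (Ne.symm h)]
  have h0 : ∀ i, i ≠ j → b.repr w i = 0 := by
    intro i hi
    have h1 := congrArg (fun g => g w) (hc i)
    simp only [LinearMap.comp_apply, hw, map_smul, LinearMap.smul_apply, Basis.coord_apply,
      smul_eq_mul] at h1
    have h2 : (μ j - μ i) * b.repr w i = 0 := by rw [sub_mul, h1, sub_self]
    exact (mul_eq_zero.1 h2).resolve_left (sub_ne_zero.2 fun h => hi (hμ h.symm))
  conv_lhs => rw [← b.sum_repr w]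
  exact Finset.sum_eq_single j (fun i _ hi => by rw [h0 i hi, zero_smul]) (by simp)

/-- A nonabelian absolutely irreducible complex representation of a `p`-group has degree at least
`p`; if its degree is `p` then the image has an abelian subgroup of index `p`. -/
theorem IsPGroup.le_finrank_of_schur {p : ℕ} [Fact p.Prime] [Finite G] (hG : IsPGroup p G)
    {V : Type*} [AddCommGroup V] [Module ℂ V] [FiniteDimensional ℂ V] [Nontrivial V]
    (ρ : G →* End ℂ V)
    (hschur : ∀ T : End ℂ V, (∀ h, T * ρ h = ρ h * T) → ∃ c : ℂ, T = c • 1)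
    (hne : ¬∀ x y, ρ x * ρ y = ρ y * ρ x) :
    p ≤ finrank ℂ V ∧ (finrank ℂ V ≤ p →
      ∃ M : Subgroup G, M.index = p ∧ ∀ x ∈ M, ∀ y ∈ M, ρ x * ρ y = ρ y * ρ x) := by
  have hp := (Fact.out : p.Prime)
  have hinv : ∀ g, ρ g * ρ g⁻¹ = 1 := fun g => by rw [← map_mul, mul_inv_cancel, map_one]
  have hinv' : ∀ g, ρ g⁻¹ * ρ g = 1 := fun g => by rw [← map_mul, inv_mul_cancel, map_one]
  -- `K` is the preimage of the centre of the image of `ρ`. An element `a` outside `K` but central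
  -- modulo `K` has all its commutators acting as scalars, and these scalars form the linear
  -- character `χ`.
  let K : Subgroup G :=
    { carrier := {x | ∀ h, ρ x * ρ h = ρ h * ρ x}
      one_mem' := fun h => by simp
      mul_mem' := fun {x y} hx hy h => by
        rw [map_mul, mul_assoc, hy, ← mul_assoc, hx, mul_assoc]
      inv_mem' := fun {x} hx h => by
        calc ρ x⁻¹ * ρ h = ρ x⁻¹ * (ρ h * ρ x) * ρ x⁻¹ := by
              rw [mul_assoc, mul_assoc, hinv, mul_one]
          _ = ρ h * ρ x⁻¹ := by rw [← hx h, ← mul_assoc, hinv', one_mul] }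
  have hK : ∀ x, x ∈ K ↔ ∀ h, ρ x * ρ h = ρ h * ρ x := fun x => Iff.rfl
  have hKn : K.Normal := ⟨fun x hx g => by
    have e : ρ (g * x * g⁻¹) = ρ x := by
      rw [map_mul, map_mul, ← (hK x).1 hx, mul_assoc, hinv, mul_one]
    rw [hK, e]
    exact hx⟩
  have hKtop : K ≠ ⊤ := fun h => hne fun x y => (hK x).1 (h ▸ Subgroup.mem_top x) y
  have : Nontrivial (G ⧸ K) := (QuotientGroup.nontrivial_iff).2 hKtop
  have := (hG.to_quotient K).center_nontrivial
  obtain ⟨⟨q, hq⟩, hq1⟩ := exists_ne (1 : Subgroup.center (G ⧸ K))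
  obtain ⟨a, rfl⟩ := QuotientGroup.mk_surjective q
  have haK : a ∉ K := fun h => hq1 (Subtype.ext ((QuotientGroup.eq_one_iff a).2 h))
  have hac : ∀ h : G, ⁅h, a⁆ ∈ K := by
    intro h
    rw [← QuotientGroup.eq_one_iff]
    exact commutatorElement_eq_one_iff_mul_comm.2 (Subgroup.mem_center_iff.1 hq (h : G ⧸ K))
  have hex : ∀ h, ∃ c : ℂ, ρ h * ρ a = c • (ρ a * ρ h) := by
    intro h
    obtain ⟨c, hc⟩ := hschur _ ((hK _).1 (hac h))
    refine ⟨c, ?_⟩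
    have : ρ h * ρ a = ρ ⁅h, a⁆ * (ρ a * ρ h) := by
      rw [← map_mul, ← map_mul, ← map_mul, commutatorElement_def]
      congr 1; group
    rw [this, hc, smul_mul_assoc, one_mul]
  choose c hc using hex
  have huniq : ∀ h (x y : ℂ), x • (ρ a * ρ h) = y • (ρ a * ρ h) → x = y := by
    intro h x y hxy
    have h0 : ρ a * ρ h ≠ 0 := by
      rw [← map_mul]
      intro h0
      have := hinv (a * h)
      rw [h0, zero_mul] at this
      exact zero_ne_one this
    exact smul_left_injective ℂ h0 hxy
  let cm : G →* ℂ :=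
    { toFun := c
      map_one' := huniq 1 _ _ (by rw [← hc]; simp)
      map_mul' := fun x y => huniq (x * y) _ _ (by
        rw [← hc, map_mul, mul_assoc, hc y, mul_smul_comm, ← mul_assoc, hc x, smul_mul_assoc,
          smul_smul, mul_assoc, mul_comm (c y)]) }
  let χ : G →* ℂˣ := cm.toHomUnits
  have hχ : ∀ h, ((χ h : ℂˣ) : ℂ) = c h := fun h => rfl
  have hker : ∀ x, x ∈ χ.ker ↔ ρ x * ρ a = ρ a * ρ x := by
    intro x
    rw [MonoidHom.mem_ker, Units.ext_iff, hχ, Units.val_one]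
    constructor
    · intro h; rw [hc, h, one_smul]
    · intro h; exact huniq x _ _ (by rw [← hc, h, one_smul])
  have hfin : Finite χ.range := Finite.of_surjective χ.rangeRestrict χ.rangeRestrict_surjective
  obtain ⟨⟨_, ⟨h₀, rfl⟩⟩, hgen⟩ := (inferInstance : IsCyclic χ.range)
  have hord : orderOf (χ h₀) = Nat.card χ.range := by
    rw [← orderOf_eq_card_of_forall_mem_zpowers hgen]
    exact (Subgroup.orderOf_mk _ _).symm
  set q := Nat.card χ.range with hq
  have hqidx : χ.ker.index = q := Subgroup.index_ker χ
  have hpq : p ≤ q := by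
    obtain ⟨j, hj⟩ := hG.index χ.ker
    rw [← hqidx, hj]
    have hj0 : j ≠ 0 := by
      rintro rfl
      rw [pow_zero, Subgroup.index_eq_one] at hj
      exact haK ((hK a).2 fun h => ((hker h).1 (hj ▸ Subgroup.mem_top h)).symm)
    exact Nat.le_self_pow hj0 p
  obtain ⟨μ, hμ⟩ := End.exists_eigenvalue (ρ a)
  obtain ⟨v, hv⟩ := hμ.exists_hasEigenvector
  have hinj : ∀ g, ∀ w : V, ρ g w = 0 → w = 0 := by
    intro g w h
    have : (ρ g⁻¹ * ρ g) w = 0 := by rw [End.mul_apply, h, map_zero]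
    rwa [hinv', End.one_apply] at this
  have hμ0 : μ ≠ 0 := by
    rintro rfl
    have := hv.apply_eq_smul
    rw [zero_smul] at this
    exact hv.2 (hinj a v this)
  -- The powers of `h₀` move one eigenvector of `ρ a` through q distinct eigenvalues, because χ(h₀)
  -- has order q. Hence the degree is at least q ≥ p.
  let vs : Fin q → V := fun j => ρ (h₀ ^ (j : ℕ)) v
  let μs : Fin q → ℂ := fun j => (((χ h₀)⁻¹ ^ (j : ℕ) : ℂˣ) : ℂ) * μ
  have hμs : Function.Injective μs := by
    intro i j hij
    have h1 := mul_right_cancel₀ hμ0 hij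
    have h2 := Units.ext h1
    have hord' : orderOf (χ h₀)⁻¹ = q := by rw [orderOf_inv, hord]
    exact Fin.ext (pow_injOn_Iio_orderOf (x := (χ h₀)⁻¹) (by rw [hord']; exact i.2)
      (by rw [hord']; exact j.2) h2)
  have hvs : ∀ j, ρ a (vs j) = μs j • vs j := by
    intro j
    have h1 := congrArg (fun T => T v) (hc (h₀ ^ (j : ℕ)))
    simp only [End.mul_apply, LinearMap.smul_apply, hv.apply_eq_smul, map_smul] at h1
    have h2 : c (h₀ ^ (j : ℕ)) = (((χ h₀) ^ (j : ℕ) : ℂˣ) : ℂ) := by rw [← hχ, map_pow]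
    change ρ a (ρ (h₀ ^ (j : ℕ)) v) =
      ((((χ h₀)⁻¹ ^ (j : ℕ) : ℂˣ) : ℂ) * μ) • ρ (h₀ ^ (j : ℕ)) v
    rw [mul_smul, h1, h2, smul_smul, ← Units.val_mul, ← mul_pow, inv_mul_cancel, one_pow,
      Units.val_one, one_smul]
  have hli : LinearIndependent ℂ vs :=
    End.eigenvectors_linearIndependent' (ρ a) μs hμs vs fun j =>
      ⟨End.mem_eigenspace_iff.2 (hvs j), fun h => hv.2 (hinj _ _ h)⟩
  have hcard := hli.fintype_card_le_finrank
  rw [Fintype.card_fin] at hcard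
  refine ⟨hpq.trans hcard, fun hle => ⟨χ.ker, by omega, fun x hx y hy => ?_⟩⟩
  have : Nonempty (Fin q) := ⟨⟨0, hp.pos.trans_le hpq⟩⟩
  let b := basisOfLinearIndependentOfCardEqFinrank hli (by rw [Fintype.card_fin]; omega)
  have hb : ∀ j, b j = vs j := fun j => by simp [b]
  -- In degree p the eigenvalues of `ρ a` are simple, so whatever commutes with `ρ a` is diagonal in
  -- its eigenbasis. The kernel of `χ` consists of the elements that do.
  have heig : ∀ z ∈ χ.ker, ∀ j, ∃ t : ℂ, ρ z (b j) = t • b j := by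
    intro z hz j
    refine ⟨_, b.eq_smul_of_mem_eigenspace hμs (fun i => by rw [hb]; exact hvs i) ?_⟩
    rw [← End.mul_apply, ← (hker z).1 hz, End.mul_apply, hb, hvs, map_smul]
  refine b.ext fun j => ?_
  obtain ⟨s, hs⟩ := heig x hx j
  obtain ⟨t, ht⟩ := heig y hy j
  rw [End.mul_apply, End.mul_apply, hs, ht, map_smul, map_smul, hs, ht, smul_comm]

theorem Matrix.exists_eq_smul_one_of_commute {d : ℕ} {M : Matrix (Fin d) (Fin d) ℂ}
    (h : ∀ N, M * N = N * M) : ∃ c : ℂ, M = c • 1 := by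
  obtain ⟨c, hc⟩ := Matrix.mem_range_scalar_of_commute_single (M := M)
    fun i j _ => (h _).symm
  exact ⟨c, by rw [← hc]; ext; simp [Matrix.scalar_apply, Matrix.diagonal_apply, Matrix.one_apply]⟩

variable {n : ℕ} {d : Fin n → ℕ} {A : Type*} [Ring A] [Algebra ℂ A]

/-- Combinations of class sums are central, hence scalar in every block. Block sizes are nonzero in
ℂ, so the traces recover these scalars. -/
theorem card_conjClasses_le_card_blocks [Finite G] {u : Basis G ℂ A} (hu : IsGroupBasis u)
    (hd : ∀ i, NeZero (d i)) (e : A ≃ₐ[ℂ] Π i, Matrix (Fin (d i)) (Fin (d i)) ℂ) :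
    Nat.card (ConjClasses G) ≤ n := by
  have := Fintype.ofFinite G
  have := Fintype.ofFinite (ConjClasses G)
  let s : (ConjClasses G → ℂ) →ₗ[ℂ] A :=
    ∑ g, (LinearMap.toSpanSingleton ℂ A (u g)) ∘ₗ LinearMap.proj (ConjClasses.mk g)
  have hs : ∀ f, s f = ∑ g, f (ConjClasses.mk g) • u g := fun f => by simp [s]
  have hs_inj : ∀ f, s f = 0 → f = 0 := by
    intro f hf
    rw [hs] at hf
    ext C
    obtain ⟨g, rfl⟩ := ConjClasses.exists_rep C
    exact Fintype.linearIndependent_iff.1 u.linearIndependent _ hf g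
  have hs_comm : ∀ f a, s f * a = a * s f := by
    intro f a
    induction a using u.elim_induction with
    | zero => simp
    | add x y hx hy => rw [mul_add, add_mul, hx, hy]
    | smul c x hx => rw [mul_smul_comm, smul_mul_assoc, hx]
    | coe h =>
      rw [hs, Finset.sum_mul, Finset.mul_sum]
      refine Finset.sum_equiv (MulAut.conj h⁻¹).toEquiv (by simp) fun g _ => ?_
      have e1 : (MulAut.conj h⁻¹).toEquiv g = h⁻¹ * g * h := by simp
      have e2 : ConjClasses.mk (h⁻¹ * g * h) = ConjClasses.mk g :=
        ConjClasses.mk_eq_mk_iff_isConj.2 (isConj_iff.2 ⟨h, by group⟩)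
      rw [e1, e2, smul_mul_assoc, mul_smul_comm, ← hu.mul, ← hu.mul]
      congr 2; group
  let L : (ConjClasses G → ℂ) →ₗ[ℂ] (Fin n → ℂ) := LinearMap.pi fun i =>
    Matrix.traceLinearMap _ ℂ ℂ ∘ₗ LinearMap.proj i ∘ₗ e.toLinearMap ∘ₗ s
  have hL : Function.Injective L := by
    rw [injective_iff_map_eq_zero]
    intro f hf
    refine hs_inj f (e.injective ?_)
    rw [map_zero]
    ext1 i
    obtain ⟨c, hc⟩ := Matrix.exists_eq_smul_one_of_commute (M := e (s f) i) fun N => by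
      obtain ⟨a, ha⟩ := e.surjective (Function.update 0 i N)
      have := congrFun (congrArg e (hs_comm f a)) i
      rwa [map_mul, map_mul, ha, Pi.mul_apply, Pi.mul_apply, Function.update_self] at this
    have htr : (e (s f) i).trace = 0 := congrFun hf i
    rw [hc, Matrix.trace_smul, Matrix.trace_one, Fintype.card_fin, smul_eq_mul] at htr
    have hdi : ((d i : ℕ) : ℂ) ≠ 0 := Nat.cast_ne_zero.2 (hd i).out
    rw [hc, (mul_eq_zero.1 htr).resolve_right hdi, zero_smul]
    rfl
  have := LinearMap.finrank_le_finrank_of_injective hL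
  rwa [finrank_fintype_fun_eq_card, finrank_fintype_fun_eq_card, Fintype.card_fin,
    ← Nat.card_eq_fintype_card] at this

theorem Matrix.mul_comm_of_eq_one {d : ℕ} (hd : d = 1) (M N : Matrix (Fin d) (Fin d) ℂ) :
    M * N = N * M := by
  subst hd
  ext i j
  obtain rfl := Subsingleton.elim i 0
  obtain rfl := Subsingleton.elim j 0
  simp [Matrix.mul_apply, mul_comm]

/-- Projection to the blocks of size one kills additive commutators, so it factors through the group
algebra of the abelianization. -/
theorem card_blocks_eq_one_le [Finite G] {u : Basis G ℂ A} (hu : IsGroupBasis u)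
    (e : A ≃ₐ[ℂ] Π i, Matrix (Fin (d i)) (Fin (d i)) ℂ) :
    Nat.card {i // d i = 1} ≤ (commutator G).index := by
  have hfd : FiniteDimensional ℂ A := Module.Finite.of_basis u
  let L : A →ₗ[ℂ] ({i // d i = 1} → ℂ) := LinearMap.pi fun i =>
    Matrix.traceLinearMap _ ℂ ℂ ∘ₗ LinearMap.proj i.1 ∘ₗ e.toLinearMap
  have hLsurj : Function.Surjective L := by
    classical
    intro f
    obtain ⟨a, ha⟩ := e.surjective fun i => if h : d i = 1 then f ⟨i, h⟩ • 1 else 0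
    refine ⟨a, ?_⟩
    ext ⟨i, hi⟩
    change (e a i).trace = _
    rw [ha]
    simp only [dif_pos hi]
    rw [Matrix.trace_smul, Matrix.trace_one, Fintype.card_fin, hi]
    simp
  have hker : LinearMap.ker (quotientMap u (commutator G)) ≤ LinearMap.ker L := by
    rw [ker_quotientMap hu, top_mul_augSpan_commutator hu]
    refine Submodule.mul_le.2 fun a _ x hx => ?_
    have : commutatorSpan ℂ A ≤ (LinearMap.ker L).comap (LinearMap.mulLeft ℂ a) := by
      refine Submodule.span_le.2 ?_
      rintro _ ⟨b, c, rfl⟩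
      change L (a * (b * c - c * b)) = 0
      ext i
      change (e (a * (b * c - c * b)) i.1).trace = 0
      rw [map_mul, map_sub, map_mul, map_mul]
      simp only [Pi.mul_apply, Pi.sub_apply]
      rw [Matrix.mul_comm_of_eq_one i.2 (e b i.1), sub_self, mul_zero, Matrix.trace_zero]
    exact this hx
  have h1 := L.finrank_range_add_finrank_ker
  have h2 := (quotientMap u (commutator G)).finrank_range_add_finrank_ker
  rw [LinearMap.range_eq_top.2 hLsurj, finrank_top, finrank_fintype_fun_eq_card] at h1
  rw [← Submodule.map_top, finrank_map_quotientMap_top] at h2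
  have h3 := Submodule.finrank_mono hker
  rw [Nat.card_eq_fintype_card]
  omega

/-- At least p^k + p² - 1 blocks exist, at most p² of size 1 and the others of size at least p.
Their squares already add up to p^(k+2) = |G|, so no block is larger than p. A representation
nontrivial on the centre of order p is faithful, and `IsPGroup.le_finrank_of_schur` applies to it.
-/
theorem IsPGroup.exists_isMulCommutative_index_eq {p : ℕ} [Fact p.Prime] [Finite G]
    (hG : IsPGroup p G) {k : ℕ} (hcard : Nat.card G = p ^ (k + 2))
    (hidx : (commutator G).index = p ^ 2) (hcen : Nat.card (Subgroup.center G) = p)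
    (hne : commutator G ≠ ⊥) (hconj : p ^ k + p ^ 2 ≤ Nat.card (ConjClasses G) + 1) :
    ∃ M : Subgroup G, M.index = p ∧ ∀ x ∈ M, ∀ y ∈ M, x * y = y * x := by
  classical
  have hp := (Fact.out : p.Prime)
  let u := MonoidAlgebra.basis G ℂ
  have hu : IsGroupBasis u := MonoidAlgebra.isGroupBasis
  have hfd : FiniteDimensional ℂ (MonoidAlgebra ℂ G) := Module.Finite.of_basis u
  have : NeZero (Nat.card G : ℂ) := ⟨Nat.cast_ne_zero.2 Nat.card_pos.ne'⟩
  obtain ⟨n, d, hd, ⟨e⟩⟩ :=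
    IsSemisimpleRing.exists_algEquiv_pi_matrix_of_isAlgClosed ℂ (MonoidAlgebra ℂ G)
  have hn := card_conjClasses_le_card_blocks hu hd e
  have hs := card_blocks_eq_one_le hu e
  have hsum : ∑ i, d i ^ 2 = p ^ (k + 2) := by
    have h1 := e.toLinearEquiv.finrank_eq
    rw [finrank_eq_nat_card_basis u, hcard, Module.finrank_pi_fintype] at h1
    rw [h1]
    refine Finset.sum_congr rfl fun i _ => ?_
    rw [Module.finrank_matrix]
    simp [sq]
  let ρ : ∀ i, G →* End ℂ (Fin (d i) → ℂ) := fun i =>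
    { toFun := fun g => Matrix.toLinAlgEquiv' (e (u g) i)
      map_one' := by rw [hu.one, map_one, Pi.one_apply, map_one]
      map_mul' := fun x y => by rw [hu.mul, map_mul, Pi.mul_apply, map_mul] }
  have hρ : ∀ i g, ρ i g = Matrix.toLinAlgEquiv' (e (u g) i) := fun i g => rfl
  have hschur : ∀ i, ∀ T : End ℂ (Fin (d i) → ℂ), (∀ h, T * ρ i h = ρ i h * T) →
      ∃ c : ℂ, T = c • 1 := by
    intro i T hT
    obtain ⟨M, rfl⟩ := (Matrix.toLinAlgEquiv' (R := ℂ) (n := Fin (d i))).surjective T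
    have hM : ∀ a, M * e a i = e a i * M := by
      intro a
      induction a using u.elim_induction with
      | zero => simp
      | add x y hx hy => rw [map_add, Pi.add_apply, mul_add, add_mul, hx, hy]
      | smul c x hx => rw [map_smul, Pi.smul_apply, mul_smul_comm, smul_mul_assoc, hx]
      | coe g =>
        have := hT g
        rw [hρ, ← map_mul, ← map_mul] at this
        exact Matrix.toLinAlgEquiv'.injective this
    obtain ⟨c, rfl⟩ := Matrix.exists_eq_smul_one_of_commute (M := M) fun N => by
      obtain ⟨a, ha⟩ := e.surjective (Function.update 0 i N)
      have := hM a
      rwa [ha, Function.update_self] at this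
    exact ⟨c, by rw [map_smul, map_one]⟩
  have hnt : ∀ i, Nontrivial (Fin (d i) → ℂ) := fun i => by
    have : Nonempty (Fin (d i)) := ⟨⟨0, Nat.pos_of_ne_zero (hd i).out⟩⟩
    infer_instance
  have hfr : ∀ i, finrank ℂ (Fin (d i) → ℂ) = d i := fun i => by simp
  have hcomm1 : ∀ i, (∀ x y, ρ i x * ρ i y = ρ i y * ρ i x) → d i = 1 := by
    intro i hi
    have hall : ∀ g, ∃ c : ℂ, e (u g) i = c • 1 := by
      intro g
      obtain ⟨c, hc⟩ := hschur i (ρ i g) fun h => hi g h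
      refine ⟨c, (Matrix.toLinAlgEquiv' (R := ℂ) (n := Fin (d i))).injective ?_⟩
      rw [map_smul, map_one, ← hc]
      rfl
    have hall' : ∀ a, ∃ c : ℂ, e a i = c • 1 := by
      intro a
      induction a using u.elim_induction with
      | zero => exact ⟨0, by simp⟩
      | add x y hx hy =>
        obtain ⟨c, hc⟩ := hx
        obtain ⟨c', hc'⟩ := hy
        exact ⟨c + c', by rw [map_add, Pi.add_apply, hc, hc', add_smul]⟩
      | smul r x hx =>
        obtain ⟨c, hc⟩ := hx
        exact ⟨r * c, by rw [map_smul, Pi.smul_apply, hc, smul_smul]⟩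
      | coe g => exact hall g
    by_contra hne1
    have hd2 : 1 < d i := by
      have := (hd i).out
      omega
    obtain ⟨a, ha⟩ := e.surjective (Function.update 0 i
      (Matrix.single ⟨0, by omega⟩ ⟨1, hd2⟩ 1))
    obtain ⟨c, hc⟩ := hall' a
    rw [ha, Function.update_self] at hc
    have := congrFun (congrFun hc ⟨0, by omega⟩) ⟨1, hd2⟩
    simp at this
  have hge : ∀ i, d i ≠ 1 → p ≤ d i := by
    intro i hi
    have := (hG.le_finrank_of_schur (ρ i) (hschur i) fun h => hi (hcomm1 i h)).1
    rwa [hfr] at this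
  have hle : ∀ i, d i ≤ p := by
    by_contra! hcon
    obtain ⟨j, hj⟩ := hcon
    -- Here q = p² - 1, the deficit of a block of size one against p². The block `j` of size above p
    -- adds a surplus of 1, which breaks the count.
    obtain ⟨q, hq⟩ := Nat.exists_eq_add_of_lt (pow_pos hp.pos 2)
    rw [zero_add] at hq
    have hterm : ∀ i, (q + 1) + (if i = j then 1 else 0) ≤ d i ^ 2 + if d i = 1 then q else 0 := by
      intro i
      by_cases h1 : d i = 1
      · have hij : i ≠ j := by
          rintro rfl
          have := hp.two_le
          omega
        rw [if_neg hij, if_pos h1, h1]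
        omega
      · rw [if_neg h1, ← hq]
        split_ifs with hij
        · subst hij
          have := Nat.pow_lt_pow_left hj two_ne_zero
          omega
        · have := Nat.pow_le_pow_left (hge i h1) 2
          omega
    have h1 := Finset.sum_le_sum fun i (_ : i ∈ Finset.univ) => hterm i
    rw [Finset.sum_add_distrib, Finset.sum_add_distrib (f := fun i => d i ^ 2), hsum,
      Finset.sum_const, Finset.card_univ,
      Fintype.card_fin, Finset.sum_ite_eq', if_pos (Finset.mem_univ j), ← Finset.sum_filter,
      Finset.sum_const, ← Fintype.card_subtype, ← Nat.card_eq_fintype_card, pow_add, hq,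
      smul_eq_mul, smul_eq_mul] at h1
    rw [hidx, hq] at hs
    rw [hq] at hconj
    have h2 : p ^ k + q ≤ n := by omega
    have h3 := Nat.mul_le_mul_right (q + 1) h2
    have h4 := Nat.mul_le_mul_right q hs
    rw [add_mul] at h3
    rw [mul_comm q] at h3
    omega
  obtain ⟨z, hz, hz1⟩ : ∃ z ∈ Subgroup.center G, z ≠ 1 := by
    have : Nontrivial (Subgroup.center G) := by
      rw [← Finite.one_lt_card_iff_nontrivial, hcen]; exact hp.one_lt
    obtain ⟨⟨z, hz⟩, hne⟩ := exists_ne (1 : Subgroup.center G)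
    exact ⟨z, hz, fun h => hne (Subtype.ext h)⟩
  obtain ⟨i, hi⟩ : ∃ i, ρ i z ≠ 1 := by
    by_contra! hcon
    refine hz1 (u.injective (e.injective ?_))
    ext1 i
    have := hcon i
    rw [← map_one (ρ i)] at this
    exact Matrix.toLinAlgEquiv'.injective this
  have hinj : Function.Injective (ρ i) := by
    -- A nontrivial kernel would meet the centre nontrivially and so, the centre having order p,
    -- contain `z`.
    have hker : (ρ i).ker = ⊥ := by
      by_contra hker
      have h1 := hG.inf_center_ne_bot (N := (ρ i).ker) hker
      have h2 := Subgroup.card_dvd_of_le (inf_le_right : (ρ i).ker ⊓ Subgroup.center G ≤ _)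
      rw [hcen, Nat.dvd_prime hp, Subgroup.card_eq_one] at h2
      have h3 := Subgroup.eq_of_le_of_card_ge (inf_le_right : (ρ i).ker ⊓ Subgroup.center G ≤ _)
        (by rw [hcen, h2.resolve_left h1])
      exact hi ((inf_eq_right.1 h3) hz)
    exact (MonoidHom.ker_eq_bot_iff _).1 hker
  have hnc : ¬∀ x y, ρ i x * ρ i y = ρ i y * ρ i x := by
    intro h
    refine hne (eq_bot_iff.2 (Subgroup.commutator_le.2 fun x _ y _ => ?_))
    rw [Subgroup.mem_bot, commutatorElement_eq_one_iff_mul_comm]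
    exact hinj (by rw [map_mul, map_mul, h])
  obtain ⟨M, hM, hMc⟩ := (hG.le_finrank_of_schur (ρ i) (hschur i) hnc).2 (by
    rw [hfr]; exact hle i)
  exact ⟨M, hM, fun x hx y hy => hinj (by rw [map_mul, map_mul, hMc x hx y hy])⟩

end ComplexRepresentations

/-! ### Maximal class and the final case distinction -/

section Main

open Module
open scoped commutatorElement

variable {F A : Type*} [Field F] [Ring A] [Algebra F A]
  {G H : Type*} [Group G] [Group H] [Finite G] [Finite H] {p : ℕ} [Fact p.Prime] [CharP F p]

theorem nilpotencyClass_eq_of_hasMaximalClass (hG : IsPGroup p G) (hH : IsPGroup p H)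
    {u : Basis G F A} {v : Basis H F A} (hu : IsGroupBasis u) (hv : IsGroupBasis v)
    (hmax : HasMaximalClass p G) {B : Subgroup G} (hB : B.index = p)
    (hBc : ∀ a ∈ B, ∀ b ∈ B, a * b = b * a) (hne : commutator G ≠ ⊥) :
    Group.nilpotencyClass H = Group.nilpotencyClass G := by
  have hp := (Fact.out : p.Prime)
  obtain ⟨-, n, hn, hcard, hcl⟩ := hmax
  obtain ⟨m, rfl⟩ := Nat.exists_eq_add_of_le' hn
  obtain ⟨hcen, hcomm⟩ := hG.card_center_eq_of_nilpotencyClass_eq hB hBc hne hcard hcl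
  have hidx : (commutator G).index = p ^ 2 := by
    have h := (commutator G).card_mul_index
    rw [hcomm, hcard, pow_add] at h
    exact Nat.eq_of_mul_eq_mul_left (pow_pos hp.pos m) h
  have hconj := hG.le_card_conjClasses_of_index_eq hB hBc hne hcard hcen
  have hcommH := card_commutator_eq hu hv
  have hcenH := (card_center_eq hG hH hu hv).symm.trans hcen
  have hneH : commutator H ≠ ⊥ := by
    rw [Ne, ← Subgroup.card_eq_one, ← hcommH, Subgroup.card_eq_one]
    exact hne
  obtain ⟨M, hM, hMc⟩ := hH.exists_isMulCommutative_index_eq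
    ((card_group_eq (u := u) v).symm.trans hcard) ((index_commutator_eq hu hv).symm.trans hidx)
    hcenH hneH (by rwa [← card_conjClasses_eq hu hv])
  exact nilpotencyClass_eq_of_index_eq hG hH hB hBc hM hMc hcen hcenH (card_group_eq (u := u) v)
    hcommH

end Main

theorem theorem2 {p : ℕ} [Fact p.Prime] {F : Type*} [Field F] [CharP F p]
    {G : Type*} [Group G] [Finite G] (hG : IsPGroup p G)
    (hcond : Monoid.exponent G = p ∨
      Group.nilpotencyClass G = 2 ∨
      IsCyclic (commutator G) ∨
      (HasMaximalClass p G ∧ ∃ A : Subgroup G, IsMulCommutative A ∧ A.index = p))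
    {H : Type*} [Group H] (hFGH : Nonempty (MonoidAlgebra F G ≃ₐ[F] MonoidAlgebra F H)) :
    Group.IsNilpotent H ∧ Group.nilpotencyClass H = Group.nilpotencyClass G := by
  obtain ⟨φ⟩ := hFGH
  have hu : IsGroupBasis (MonoidAlgebra.basis G F) := MonoidAlgebra.isGroupBasis
  -- The basis of the second group algebra, pulled back along the isomorphism. It need not respect
  -- the augmentation given by `G`.
  let v : Module.Basis H F (MonoidAlgebra F G) :=
    (MonoidAlgebra.basis H F).map φ.symm.toLinearEquiv
  have hv : IsGroupBasis v := fun x y => by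
    have h : (MonoidAlgebra.basis H F) (x * y) = _ := MonoidAlgebra.isGroupBasis x y
    simp only [v, Module.Basis.map_apply, AlgEquiv.toLinearEquiv_apply]
    rw [h, map_mul]
  have hfin : Finite H := Finite.of_equiv G ((MonoidAlgebra.basis G F).indexEquiv v)
  have hcard := card_group_eq (u := MonoidAlgebra.basis G F) v
  have hH : IsPGroup p H := by
    rw [IsPGroup.iff_card, ← hcard]
    exact IsPGroup.iff_card.1 hG
  have hnG := hG.isNilpotent
  have hnH := hH.isNilpotent
  have hcomm := card_commutator_eq hu hv
  have hcen := card_center_inf_commutator_eq hG hH hu hv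
  have hcyc (h : IsCyclic (commutator G)) : Group.nilpotencyClass H = Group.nilpotencyClass G :=
    nilpotencyClass_eq_of_isCyclic_commutator hG hH h
      (isCyclic_commutator_of_isCyclic_commutator hH hu hv h) hcard hcomm hcen
  refine ⟨hnH, ?_⟩
  obtain hexp | hcl | hcyclic | ⟨hmax, B, hBc, hB⟩ := hcond
  · exact nilpotencyClass_eq_of_exponent_eq hG hH hu hv hexp
  · exact (nilpotencyClass_eq_two_of_card_eq hcl hcomm hcen).trans hcl.symm
  · exact hcyc hcyclic
  -- The counting for maximal class requires a nonabelian group; an abelian one has trivial, hence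
  -- cyclic, commutator subgroup.
  · by_cases hne : commutator G = ⊥
    · have : Subsingleton (commutator G) := by rw [hne]; infer_instance
      exact hcyc inferInstance
    · exact nilpotencyClass_eq_of_hasMaximalClass hG hH hu hv hmax hB
        (fun a ha b hb => congrArg Subtype.val (hBc.is_comm.comm ⟨a, ha⟩ ⟨b, hb⟩)) hne
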